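/- **Conventions.** For a topological space $X$ let $\mathcal O(X)$ be the poset of nonempty open subsets, $\mathsf{RO}(X)$ the complete Boolean algebra of regular open subsets, $\mathrm{Reg}(U)$ the interior of the closure of $U$. For a Boolean algebra $B$ let $\mathrm{St}(B)$ be its Stone space of ultrafilters, with basic sets $N_b=\{G: b\in G\}$. A complete homomorphism $i:\mathsf{RO}(X)\to\mathsf{RO}(Y)$ (a Boolean homomorphism preserving suprema) has a left adjoint $\pi_i:\mathsf{RO}(Y)\to\mathsf{RO}(X)$ and a dual map $\pi_i^*:\mathrm{St}(\mathsf{RO}(Y))\to\mathrm{St}(\mathsf{RO}(X))$, $G\mapsto i^{-1}[G]$. For a presheaf $\mathcal F:\mathcal O(X)^{op}\to\mathsf{Set}$ let $i_*(\mathcal F)(U)=\mathcal F(\pi_i(\mathrm{Reg}\,U))$ for $U\in\mathcal O(Y)$. **Categories.** The objects of $\mathrm{Presh}^*(\mathsf{Set})$ are the pairs of a topological space $X$ in which every nonempty open set contains a nonempty regular open set, and a presheaf $\mathcal F:\mathcal O(X)^{op}\to\mathsf{Set}$. A morphism from $\mathcal F_0$ on $X_0$ to $\mathcal F_1$ on $X_1$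 is a pair $(i,\Theta)$ of a complete homomorphism $i:\mathsf{RO}(X_0)\to\mathsf{RO}(X_1)$ and a natural transformation $\Theta:i_*(\mathcal F_0)\to\mathcal F_1$; the composite is $(j,\Psi)\circ(i,\Theta)=(j\circ i,\Psi\circ j_*(\Theta))$. $\mathrm{Sh}^*(\mathsf{Set})$ is the full subcategory of the stonean sheaves: sheaves for the dense Grothendieck topology on $\mathcal O(X)$, where $X$ is compact Hausdorff and extremally disconnected. **Sheafification.** Let $\mathcal F$ be a presheaf on any space $X$. For $G\in \mathrm{St}(\mathsf{RO}(X))$, $f\in\mathcal F(U_f)$, $g\in\mathcal F(U_g)$ with $\mathrm{Reg}(U_f),\mathrm{Reg}(U_g)\in G$, put $f\equiv_G g$ if there is an open $U\subseteq U_f\cap U_g$ with $\mathrm{Reg}(U)\in G$ such that every nonempty open $W\subseteq U$ contains a nonempty open $V$ with $f\restriction V=g\restriction V$. Let $[f]_G$ be the class of $f$ and $\Lambda^1_{\mathcal F}$ the disjoint union over $G$ of the sets of classes, with projection $p^1_{\mathcal F}:[f]_G\mapsto G$ and the topology generated by the sets $\{[f]_G: q\in G\}$, for $f\in \mathcal F(U)$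 and $q\in\mathsf{RO}(X)$, $q\subseteq\mathrm{Reg}(U)$. Let $\Gamma^1\Lambda^1(\mathcal F)$ be the presheaf on $\mathrm{St}(\mathsf{RO}(X))$ which sends $U$ to the set of continuous maps $s$ from $U$ to the one-point compactification of $\Lambda^1_{\mathcal F}$ for which there is a dense open subset of $U$ on which $s$ takes values in $\Lambda^1_{\mathcal F}$ and is a section of $p^1_{\mathcal F}$; restriction is restriction of maps. For a morphism $(i,\Theta):\mathcal F_0\to\mathcal F_1$, the morphism $\Gamma^1\Lambda^1(i,\Theta)=(i^1,\Theta^1)$ is determined by: $i^1(W)=(\pi_i^*)^{-1}[W]$ (so $N_U\mapsto N_{i(U)}$); and for each section $s$ of $i^1_*(\Gamma^1\Lambda^1(\mathcal F_0))$ over $A$ and each $G\in A$, if $s(\pi_i^*(G))=[f]_{\pi_i^*(G)}$ with $f\in\mathcal F_0(U)$, $U$ regular open, $i(U)\in G$, then $\Theta^1_A(s)(G)=[\Theta_{i(U)}(f\restriction\pi_i(i(U)))]_G$. **Theorem.** (1) For every presheaf $\mathcal F$ on any topological space $X$, $\mathrm{St}(\mathsf{RO}(X))$ is compact, Hausdorff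 and extremally disconnected, and $\Gamma^1\Lambda^1(\mathcal F)$ is a stonean sheaf on it. (2) For every morphism $(i,\Theta):\mathcal F_0\to\mathcal F_1$ of $\mathrm{Presh}^*(\mathsf{Set})$ there is exactly one morphism $(i^1,\Theta^1):\Gamma^1\Lambda^1(\mathcal F_0)\to\Gamma^1\Lambda^1(\mathcal F_1)$ as just described. (3) With these actions on objects and morphisms, $\Gamma^1\circ\Lambda^1$ is a functor $\mathrm{Presh}^*(\mathsf{Set})\to\mathrm{Sh}^*(\mathsf{Set})$, and it is left adjoint to the inclusion functor $\mathrm{Sh}^*(\mathsf{Set})\to\mathrm{Presh}^*(\mathsf{Set})$. -/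

import Mathlib

open CategoryTheory TopologicalSpace Opposite

universe u

namespace StoneanSheafification

/-! ### Regular open sets, Stone spaces, complete homomorphisms -/

/-- The Boolean algebra of regular open subsets of `X` (the opens `U` with `Uᶜᶜ = U` in the frame of
opens; `Uᶜᶜ` is the interior of the closure of `U`, see `coe_reg`). -/
abbrev RO (X : Type u) [TopologicalSpace X] : Type u := Heyting.Regular (Opens X)

/-- The regularization of an open set. -/
abbrev reg {X : Type u} [TopologicalSpace X] (U : Opens X) : RO X := Heyting.Regular.toRegular U

theorem coe_compl_opens {X : Type u} [TopologicalSpace X] (U : Opens X) :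
    ((Uᶜ : Opens X) : Set X) = (closure (U : Set X))ᶜ := by
  rw [← interior_compl]
  apply Set.Subset.antisymm
  · refine interior_maximal ?_ (Uᶜ : Opens X).isOpen
    intro x hx hxU
    have : x ∈ (Uᶜ ⊓ U : Opens X) := ⟨hx, hxU⟩
    rw [compl_inf_self] at this
    exact this
  · have h : (⟨interior (U : Set X)ᶜ, isOpen_interior⟩ : Opens X) ≤ Uᶜ := by
      rw [le_compl_iff_disjoint_right, disjoint_iff_inf_le]
      rintro x ⟨h1, h2⟩
      exact (interior_subset h1 h2).elim
    exact h

theorem coe_reg {X : Type u} [TopologicalSpace X] (U : Opens X) :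
    (((reg U : RO X) : Opens X) : Set X) = interior (closure (U : Set X)) := by
  rw [Heyting.Regular.coe_toRegular, coe_compl_opens, coe_compl_opens, closure_compl, compl_compl]

/-- `O(X)`: the nonempty open subsets of `X`, ordered by inclusion. -/
abbrev NOpens (X : Type u) [TopologicalSpace X] : Type u := {U : Opens X // (U : Set X).Nonempty}

/-- `RO(X)⁺`: the nonzero regular open subsets of `X`, ordered by inclusion. -/
abbrev ROpos (X : Type u) [TopologicalSpace X] : Type u := {U : RO X // U ≠ ⊥}

theorem nonempty_of_ne_bot {X : Type u} [TopologicalSpace X] {U : RO X} (h : U ≠ ⊥) :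
    ((U : Opens X) : Set X).Nonempty := by
  by_contra hU
  apply h
  apply Heyting.Regular.coe_injective
  ext x
  exact ⟨fun hx => (hU ⟨x, hx⟩).elim, fun hx => hx.elim⟩

theorem reg_ne_bot {X : Type u} [TopologicalSpace X] (U : NOpens X) : reg U.1 ≠ ⊥ := by
  intro h
  obtain ⟨x, hx⟩ := U.2
  have h1 : (U.1 : Opens X) ≤ (reg U.1 : RO X) := le_compl_compl
  rw [h] at h1
  exact h1 hx

/-- The inclusion of `RO(X)⁺` into `O(X)`. -/
def inclRO (X : Type u) [TopologicalSpace X] : ROpos X ⥤ NOpens X :=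
  Monotone.functor (f := fun U : ROpos X => (⟨(U.1 : Opens X), nonempty_of_ne_bot U.2⟩ : NOpens X))
    fun _ _ h => h

/-- Regularization, as a monotone map `O(X) → RO(X)⁺`. -/
def regFunctor (X : Type u) [TopologicalSpace X] : NOpens X ⥤ ROpos X :=
  Monotone.functor (f := fun U : NOpens X => (⟨reg U.1, reg_ne_bot U⟩ : ROpos X))
    fun U V h => (Heyting.Regular.toRegular.monotone (show U.1 ≤ V.1 from h) : reg U.1 ≤ reg V.1)

/-- `RO(X)` is a dense subset of `O(X)`: every nonempty open set contains a nonempty regular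
open set. -/
def RODense (X : Type u) [TopologicalSpace X] : Prop :=
  ∀ U : NOpens X, ∃ V : ROpos X, (V.1 : Opens X) ≤ U.1

/-- The Stone space of a Boolean algebra: its points are the ultrafilters. -/
@[ext]
structure St (B : Type u) [BooleanAlgebra B] : Type u where
  carrier : Set B
  top_mem : ⊤ ∈ carrier
  bot_notMem : ⊥ ∉ carrier
  mem_of_le : ∀ {a b : B}, a ∈ carrier → a ≤ b → b ∈ carrier
  inf_mem : ∀ {a b : B}, a ∈ carrier → b ∈ carrier → a ⊓ b ∈ carrier
  mem_or_compl_mem : ∀ a : B, a ∈ carrier ∨ aᶜ ∈ carrier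

instance {B : Type u} [BooleanAlgebra B] : Membership B (St B) := ⟨fun G b => b ∈ G.carrier⟩

/-- The basic set `N_b` of ultrafilters containing `b`. -/
def St.N {B : Type u} [BooleanAlgebra B] (b : B) : Set (St B) := {G | b ∈ G}

instance {B : Type u} [BooleanAlgebra B] : TopologicalSpace (St B) :=
  TopologicalSpace.generateFrom (Set.range St.N)

theorem St.isOpen_N {B : Type u} [BooleanAlgebra B] (b : B) : IsOpen (St.N b) :=
  TopologicalSpace.isOpen_generateFrom_of_mem ⟨b, rfl⟩

theorem St.compl_N {B : Type u} [BooleanAlgebra B] (b : B) : (St.N b)ᶜ = St.N bᶜ := by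
  ext G
  constructor
  · intro h
    exact (G.mem_or_compl_mem b).resolve_left h
  · intro h h'
    apply G.bot_notMem
    have := G.inf_mem h' h
    rwa [inf_compl_self] at this

theorem St.isTopologicalBasis {B : Type u} [BooleanAlgebra B] :
    IsTopologicalBasis (Set.range (St.N : B → Set (St B))) where
  exists_subset_inter := by
    rintro _ ⟨a, rfl⟩ _ ⟨b, rfl⟩ G ⟨ha, hb⟩
    exact ⟨_, ⟨a ⊓ b, rfl⟩, G.inf_mem ha hb, fun H hH =>
      ⟨H.mem_of_le hH inf_le_left, H.mem_of_le hH inf_le_right⟩⟩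
  sUnion_eq := Set.eq_univ_of_forall fun G => ⟨_, ⟨⊤, rfl⟩, G.top_mem⟩
  eq_generateFrom := rfl

theorem St.isRegular_N {B : Type u} [BooleanAlgebra B] (b : B) :
    Heyting.IsRegular (⟨St.N b, St.isOpen_N b⟩ : Opens (St B)) := by
  have hc : IsClosed (St.N b) := by
    rw [← isOpen_compl_iff, St.compl_N]
    exact St.isOpen_N _
  apply SetLike.coe_injective
  rw [coe_compl_opens, coe_compl_opens, closure_compl, compl_compl]
  change interior (closure (St.N b)) = St.N b
  rw [hc.closure_eq, (St.isOpen_N b).interior_eq]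

theorem St.roDense (B : Type u) [BooleanAlgebra B] : RODense (St B) := by
  rintro ⟨U, G, hG⟩
  obtain ⟨_, ⟨b, rfl⟩, hb, hbU⟩ := St.isTopologicalBasis.exists_subset_of_mem_open hG U.isOpen
  refine ⟨⟨⟨⟨St.N b, St.isOpen_N b⟩, St.isRegular_N b⟩, fun h => ?_⟩, hbU⟩
  have h1 : (⟨St.N b, St.isOpen_N b⟩ : Opens (St B)) = ⊥ := congrArg Heyting.Regular.val h
  have h2 : G ∈ (⟨St.N b, St.isOpen_N b⟩ : Opens (St B)) := hb
  rw [h1] at h2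
  exact h2

/-- A complete homomorphism of Boolean algebras: a homomorphism which preserves all existing
suprema. -/
@[ext]
structure CompleteHom (B C : Type u) [BooleanAlgebra B] [BooleanAlgebra C] extends
    BoundedLatticeHom B C where
  map_isLUB : ∀ (A : Set B) (a : B), IsLUB A a →
    IsLUB (toBoundedLatticeHom '' A) (toBoundedLatticeHom a)

instance {B C : Type u} [BooleanAlgebra B] [BooleanAlgebra C] :
    CoeFun (CompleteHom B C) (fun _ => B → C) := ⟨fun i => i.toBoundedLatticeHom⟩

/-- The identity complete homomorphism. -/
def CompleteHom.id (B : Type u) [BooleanAlgebra B] : CompleteHom B B where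
  toBoundedLatticeHom := BoundedLatticeHom.id B
  map_isLUB A a h := by simpa using h

/-- Composition of complete homomorphisms (`i` first, then `j`). -/
def CompleteHom.comp {B C D : Type u} [BooleanAlgebra B] [BooleanAlgebra C] [BooleanAlgebra D]
    (i : CompleteHom B C) (j : CompleteHom C D) : CompleteHom B D where
  toBoundedLatticeHom := j.toBoundedLatticeHom.comp i.toBoundedLatticeHom
  map_isLUB A a h := by
    have := j.map_isLUB _ _ (i.map_isLUB A a h)
    rw [Set.image_image] at this
    exact this

/-- The dual map `π*_i : St(C) → St(B)`, `G ↦ i⁻¹[G]`. -/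
def piStar {B C : Type u} [BooleanAlgebra B] [BooleanAlgebra C] (i : CompleteHom B C) (G : St C) :
    St B where
  carrier := {b | i b ∈ G.carrier}
  top_mem := by
    change i.toBoundedLatticeHom ⊤ ∈ G.carrier
    rw [map_top]
    exact G.top_mem
  bot_notMem := by
    change i.toBoundedLatticeHom ⊥ ∉ G.carrier
    rw [map_bot]
    exact G.bot_notMem
  mem_of_le ha h := G.mem_of_le ha (OrderHomClass.mono i.toBoundedLatticeHom h)
  inf_mem {a b} ha hb := by
    change i.toBoundedLatticeHom (a ⊓ b) ∈ G.carrier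
    rw [map_inf]
    exact G.inf_mem ha hb
  mem_or_compl_mem a := by
    change _ ∨ i.toBoundedLatticeHom aᶜ ∈ G.carrier
    rw [map_compl']
    exact G.mem_or_compl_mem _

section Pi

variable {X Y Z : Type u} [TopologicalSpace X] [TopologicalSpace Y] [TopologicalSpace Z]

/-- The left adjoint `π_i : RO(Y) → RO(X)` of `i : RO(X) → RO(Y)`: `π_i(c)` is the infimum in
`RO(X)` of the `b` with `c ≤ i(b)`. -/
def pi (i : CompleteHom (RO X) (RO Y)) (c : RO Y) : RO X :=
  reg (sInf {V : Opens X | ∃ b : RO X, c ≤ i b ∧ V = b})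

theorem pi_isGLB (i : CompleteHom (RO X) (RO Y)) (c : RO Y) : IsGLB {b : RO X | c ≤ i b} (pi i c) := by
  constructor
  · intro b hb
    rw [← Heyting.Regular.toRegular_coe b]
    exact Heyting.Regular.toRegular.monotone (sInf_le ⟨b, hb, rfl⟩)
  · intro d hd
    rw [← Heyting.Regular.toRegular_coe d]
    refine Heyting.Regular.toRegular.monotone (le_sInf ?_)
    rintro _ ⟨b, hb, rfl⟩
    exact hd hb

theorem pi_gc (i : CompleteHom (RO X) (RO Y)) : GaloisConnection (pi i) i := by
  intro c b
  have hmono : Monotone i := OrderHomClass.mono i.toBoundedLatticeHom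
  refine ⟨fun h => le_trans ?_ (hmono h), fun h => (pi_isGLB i c).1 h⟩
  have h1 : IsLUB (compl '' {b : RO X | c ≤ i b}) (pi i c)ᶜ := by
    constructor
    · rintro _ ⟨b, hb, rfl⟩
      exact compl_le_compl ((pi_isGLB i c).1 hb)
    · intro d hd
      rw [compl_le_iff_compl_le]
      refine (pi_isGLB i c).2 fun b hb => ?_
      rw [compl_le_iff_compl_le]
      exact hd ⟨b, hb, rfl⟩
  have h2 := (i.map_isLUB _ _ h1).2 (show cᶜ ∈ upperBounds _ from ?_)
  · rw [map_compl'] at h2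
    exact compl_le_compl_iff_le.1 h2
  · rintro _ ⟨_, ⟨b, hb, rfl⟩, rfl⟩
    rw [map_compl']
    exact compl_le_compl hb

theorem pi_ne_bot (i : CompleteHom (RO X) (RO Y)) (c : ROpos Y) : pi i c.1 ≠ ⊥ := by
  intro h
  have h1 := (pi_gc i).le_u_l c.1
  rw [h] at h1
  have h2 : i ⊥ = ⊥ := map_bot i.toBoundedLatticeHom
  rw [h2] at h1
  exact c.2 (le_bot_iff.1 h1)

theorem pi_id (c : RO X) : pi (CompleteHom.id (RO X)) c = c :=
  ((pi_gc (CompleteHom.id (RO X))).l_unique GaloisConnection.id fun _ => rfl)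

theorem pi_comp (i : CompleteHom (RO X) (RO Y)) (j : CompleteHom (RO Y) (RO Z)) (c : RO Z) :
    pi (i.comp j) c = pi i (pi j c) :=
  (pi_gc (i.comp j)).l_unique ((pi_gc j).compose (pi_gc i)) fun _ => rfl

/-- `π_i` as a monotone map `RO(Y)⁺ → RO(X)⁺`. -/
def piFunctor (i : CompleteHom (RO X) (RO Y)) : ROpos Y ⥤ ROpos X :=
  Monotone.functor (f := fun c => ⟨pi i c.1, pi_ne_bot i c⟩) fun _ _ h => (pi_gc i).monotone_l h

end Pi

/-! ### Presheaves and their lifting along complete homomorphisms -/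

/-- Presheaves on the nonempty open subsets of `X`. -/
abbrev Presh (X : Type u) [TopologicalSpace X] := (NOpens X)ᵒᵖ ⥤ Type u

section Push

variable {X Y Z : Type u} [TopologicalSpace X] [TopologicalSpace Y] [TopologicalSpace Z]

/-- The map `U ↦ π_i(Reg U)` from `O(Y)` to `O(X)`. -/
def pushOpen (i : CompleteHom (RO X) (RO Y)) : NOpens Y ⥤ NOpens X :=
  regFunctor Y ⋙ piFunctor i ⋙ inclRO X

/-- `i_*(ℱ) = ext(i_*(ℱ ↾ RO(X)))`, with its action on natural transformations. Here
`i_*(𝒢)(U) = 𝒢(π_i(U))` for a presheaf `𝒢` on the regular open sets and `U` regular open, and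
`ext(𝒢)(U) = 𝒢(Reg U)` is the left adjoint of the restriction to the regular open sets. Hence
`i_*(ℱ)(U) = ℱ(π_i(Reg U))`. -/
def push (i : CompleteHom (RO X) (RO Y)) : Presh X ⥤ Presh Y :=
  (Functor.whiskeringLeft _ _ _).obj (pushOpen i).op

theorem map_square (F : Presh X) {a b c d : (NOpens X)ᵒᵖ} (f : a ⟶ b) (g : b ⟶ d) (h : a ⟶ c)
    (k : c ⟶ d) : F.map f ≫ F.map g = F.map h ≫ F.map k := by
  rw [← F.map_comp, ← F.map_comp]
  rfl

theorem map_loop (F : Presh X) {a b : (NOpens X)ᵒᵖ} (f : a ⟶ b) (g : b ⟶ a) :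
    F.map f ≫ F.map g = 𝟙 _ := by
  rw [← F.map_comp, ← F.map_id]
  rfl

theorem le_pushOpen_id (U : NOpens X) : U ≤ (pushOpen (CompleteHom.id (RO X))).obj U := by
  change U.1 ≤ ((pi (CompleteHom.id (RO X)) (reg U.1) : RO X) : Opens X)
  rw [pi_id]
  exact le_compl_compl

theorem pushOpen_comp (i : CompleteHom (RO X) (RO Y)) (j : CompleteHom (RO Y) (RO Z))
    (U : NOpens Z) : (pushOpen (i.comp j)).obj U = (pushOpen i).obj ((pushOpen j).obj U) := by
  apply Subtype.ext
  have h : reg ((pi j (reg U.1) : RO Y) : Opens Y) = pi j (reg U.1) :=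
    Heyting.Regular.toRegular_coe _
  change ((pi (i.comp j) (reg U.1) : RO X) : Opens X) =
    (pi i (reg ((pi j (reg U.1) : RO Y) : Opens Y)) : RO X)
  rw [h, pi_comp]

/-- The canonical map `id_*(ℱ) → ℱ`, given by restriction along `U ⊆ Reg U`. -/
def pushId (F : Presh X) : (push (CompleteHom.id (RO X))).obj F ⟶ F where
  app U := F.map (homOfLE (le_pushOpen_id U.unop)).op
  naturality _ _ _ := map_square F _ _ _ _

/-- The canonical identification `(j ∘ i)_*(ℱ) = j_*(i_*(ℱ))`. -/
def pushComp (i : CompleteHom (RO X) (RO Y)) (j : CompleteHom (RO Y) (RO Z)) (F : Presh X) :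
    (push (i.comp j)).obj F ⟶ (push j).obj ((push i).obj F) where
  app U := F.map (homOfLE (pushOpen_comp i j U.unop).ge).op
  naturality _ _ _ := map_square F _ _ _ _

end Push

/-! ### The categories of presheaves and of stonean sheaves over varying spaces -/

/-- An object of `Presh*(Set)`: a presheaf on the nonempty open subsets of a topological space whose
regular open sets are dense in the nonempty open sets. -/
structure PreshStar : Type (u + 1) where
  space : Type u
  [top : TopologicalSpace space]
  dense : RODense space
  presheaf : Presh space

attribute [instance] PreshStar.top

/-- A morphism of `Presh*(Set)`: a complete homomorphism `i : RO(X₀) → RO(X₁)` together with a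
natural transformation `Θ : i_*(ℱ₀) → ℱ₁`. -/
@[ext]
structure PreshStar.Hom (F G : PreshStar.{u}) : Type u where
  hom : CompleteHom (RO F.space) (RO G.space)
  trans : (push hom).obj F.presheaf ⟶ G.presheaf

theorem assoc_aux {C : Type*} [Category C] {x₁ x₂ x₃ x₄ x₅ x₆ x₇ x₈ : C} {m₁ : x₁ ⟶ x₂}
    {m₂ : x₂ ⟶ x₃} {m₃ : x₁ ⟶ x₄} {m₄ : x₄ ⟶ x₃} {a : x₃ ⟶ x₅} {a' : x₄ ⟶ x₆} {g : x₆ ⟶ x₅}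
    (h : m₁ ≫ m₂ = m₃ ≫ m₄) (h' : m₄ ≫ a = a' ≫ g) (b : x₅ ⟶ x₇) (c : x₇ ⟶ x₈) :
    m₁ ≫ (m₂ ≫ a ≫ b) ≫ c = m₃ ≫ a' ≫ g ≫ b ≫ c := by
  rw [← Category.assoc a' g, ← h', Category.assoc, Category.assoc, Category.assoc,
    ← Category.assoc m₁ m₂, h, Category.assoc]

/-- The composition is `(i, Θ) ≫ (j, Ψ) = (j ∘ i, Ψ ∘ j_*(Θ))`. -/
instance : Category.{u} PreshStar.{u} where
  Hom := PreshStar.Hom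
  id F := ⟨CompleteHom.id _, pushId F.presheaf⟩
  comp {F _ _} a b := ⟨a.hom.comp b.hom,
    pushComp a.hom b.hom F.presheaf ≫ (push b.hom).map a.trans ≫ b.trans⟩
  id_comp {F G} b := by
    refine PreshStar.Hom.ext rfl (heq_of_eq (NatTrans.ext (funext fun U => ?_)))
    exact (Category.assoc _ _ _).symm.trans
      ((congrArg (· ≫ b.trans.app U) (map_loop F.presheaf _ _)).trans (Category.id_comp _))
  comp_id {F G} b := by
    refine PreshStar.Hom.ext rfl (heq_of_eq (NatTrans.ext (funext fun U => ?_)))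
    have h := b.trans.naturality (homOfLE (le_pushOpen_id U.unop)).op
    refine (congrArg (F.presheaf.map _ ≫ ·) h.symm).trans ?_
    exact (Category.assoc _ _ _).symm.trans
      ((congrArg (· ≫ b.trans.app U) (map_loop F.presheaf _ _)).trans (Category.id_comp _))
  assoc {F G K L} a b c := by
    refine PreshStar.Hom.ext rfl (heq_of_eq (NatTrans.ext (funext fun U => ?_)))
    have h := a.trans.naturality (homOfLE (pushOpen_comp b.hom c.hom U.unop).ge).op
    have h2 := map_square F.presheaf
      (homOfLE (pushOpen_comp (a.hom.comp b.hom) c.hom U.unop).ge).op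
      (homOfLE (pushOpen_comp a.hom b.hom ((pushOpen c.hom).obj U.unop)).ge).op
      (homOfLE (pushOpen_comp a.hom (b.hom.comp c.hom) U.unop).ge).op
      ((pushOpen a.hom).op.map (homOfLE (pushOpen_comp b.hom c.hom U.unop).ge).op)
    exact assoc_aux h2 h (b.trans.app ((pushOpen c.hom).op.obj U)) (c.trans.app U)

/-- `ℱ` is a sheaf for the dense Grothendieck topology on the nonempty open sets. -/
def IsDenseSheaf {X : Type u} [TopologicalSpace X] (F : Presh X) : Prop :=
  Presieve.IsSheaf (GrothendieckTopology.dense : GrothendieckTopology (NOpens X)) F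

/-- The objects of `Sh*(Set)`: sheaves for the dense Grothendieck topology on an extremally
disconnected compact Hausdorff space. -/
def isStoneanSheaf : ObjectProperty PreshStar.{u} := fun F =>
  CompactSpace F.space ∧ T2Space F.space ∧ ExtremallyDisconnected F.space ∧ IsDenseSheaf F.presheaf

/-- `Sh*(Set)`, a full subcategory of `Presh*(Set)`. -/
abbrev ShStar := (isStoneanSheaf.{u}).FullSubcategory

/-! ### The bundle `Λ¹` -/

section Lambda

variable {X : Type u} [TopologicalSpace X] (F : Presh X)

/-- The sections of `ℱ` over the open sets `U` with `Reg U ∈ G`, i.e. over the members of the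
maximal filter of open sets induced by `G`. -/
def PreGerm (G : St (RO X)) : Type u := Σ U : {U : NOpens X // reg U.1 ∈ G}, F.obj (op U.1)

/-- `f ≡_G g`: for some `U` in the maximal filter of open sets induced by `G`, contained in the
domains of `f` and `g`, the set of open `V` on which `f` and `g` agree is dense below `U`. -/
def GermRel (G : St (RO X)) (f g : PreGerm F G) : Prop :=
  ∃ (U : NOpens X) (hf : U ≤ f.1.1) (hg : U ≤ g.1.1), reg U.1 ∈ G ∧
    ∀ W : NOpens X, ∀ hW : W ≤ U, ∃ (V : NOpens X) (hV : V ≤ W),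
      F.map (homOfLE ((hV.trans hW).trans hf)).op f.2 =
        F.map (homOfLE ((hV.trans hW).trans hg)).op g.2

theorem germRel_equivalence (G : St (RO X)) : Equivalence (GermRel F G) where
  refl f := ⟨f.1.1, le_rfl, le_rfl, f.1.2, fun W _ => ⟨W, le_rfl, rfl⟩⟩
  symm := by
    rintro f g ⟨U, hf, hg, hU, h⟩
    refine ⟨U, hg, hf, hU, fun W hW => ?_⟩
    obtain ⟨V, hV, e⟩ := h W hW
    exact ⟨V, hV, e.symm⟩
  trans := by
    rintro f g k ⟨U, hf, hg, hU, h⟩ ⟨U', hg', hk, hU', h'⟩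
    have hreg : reg (U.1 ⊓ U'.1) ∈ G := by
      have e : reg (U.1 ⊓ U'.1) = reg U.1 ⊓ reg U'.1 := by
        apply Heyting.Regular.coe_injective
        exact compl_compl_inf_distrib _ _
      rw [e]
      exact G.inf_mem hU hU'
    have hne : ((U.1 ⊓ U'.1 : Opens X) : Set X).Nonempty := by
      by_contra hE
      apply G.bot_notMem
      have e : U.1 ⊓ U'.1 = ⊥ := by
        ext x
        exact ⟨fun hx => (hE ⟨x, hx⟩).elim, fun hx => hx.elim⟩
      have e' : reg (⊥ : Opens X) = ⊥ := Heyting.Regular.toRegular_coe ⊥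
      rw [e, e'] at hreg
      exact hreg
    have hl : (⟨U.1 ⊓ U'.1, hne⟩ : NOpens X) ≤ U := (inf_le_left : U.1 ⊓ U'.1 ≤ U.1)
    have hr : (⟨U.1 ⊓ U'.1, hne⟩ : NOpens X) ≤ U' := (inf_le_right : U.1 ⊓ U'.1 ≤ U'.1)
    refine ⟨⟨U.1 ⊓ U'.1, hne⟩, hl.trans hf, hr.trans hk, hreg, fun W hW => ?_⟩
    obtain ⟨V, hV, e⟩ := h W (hW.trans hl)
    obtain ⟨V', hV', e'⟩ := h' V ((hV.trans hW).trans hr)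
    refine ⟨V', hV'.trans hV, ?_⟩
    have e1 := congrArg (F.map (homOfLE hV').op) e
    rw [← ConcreteCategory.comp_apply, ← ConcreteCategory.comp_apply, ← F.map_comp,
      ← F.map_comp] at e1
    exact e1.trans e'

/-- The stalk `ℱ_G`. -/
def Stalk (G : St (RO X)) : Type u := Quotient ⟨GermRel F G, germRel_equivalence F G⟩

/-- The total space `Λ¹`: the disjoint union of the stalks. -/
structure Lambda1 : Type u where
  /-- the bundle projection `p¹ : Λ¹ → St(RO(X))` -/
  proj : St (RO X)
  germ : Stalk F proj

variable {F}

/-- The map `G ↦ [f]_G` defined by `f ∈ ℱ(U)` on the `G` with `Reg U ∈ G`. -/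
def dot {U : NOpens X} (f : F.obj (op U)) (G : St (RO X)) (hG : reg U.1 ∈ G) : Lambda1 F :=
  ⟨G, Quotient.mk _ (⟨⟨U, hG⟩, f⟩ : PreGerm F G)⟩

/-- The topology of `Λ¹` is generated by the images of the regular open `q ⊆ Reg U` under the maps
`G ↦ [f]_G`, for `f ∈ ℱ(U)`. -/
instance : TopologicalSpace (Lambda1 F) :=
  TopologicalSpace.generateFrom
    {S | ∃ (U : NOpens X) (f : F.obj (op U)) (q : RO X) (hq : q ≤ reg U.1),
      S = {e | ∃ (G : St (RO X)) (hG : q ∈ G), e = dot f G (G.mem_of_le hG hq)}}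

end Lambda

/-! ### The presheaf `Γ¹` -/

section Gamma

variable {E Y : Type u} [TopologicalSpace E] [TopologicalSpace Y] (p : E → Y)

/-- `Γ¹_p(U)`: the continuous maps `s` from `U` to the one-point compactification of `E` such that,
on some dense open subset `D` of `U`, `s` takes values in `E` and is a section of `p`. -/
def Gamma1Sections (U : Opens Y) : Type u :=
  {s : C(U, OnePoint E) // ∃ (D : Opens Y) (hD : D ≤ U), (U : Set Y) ⊆ closure (D : Set Y) ∧
    ∀ (x : Y) (hx : x ∈ D), ∃ e : E, s ⟨x, hD hx⟩ = (e : OnePoint E) ∧ p e = x}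

/-- Restriction of sections of `Γ¹_p`. -/
def Gamma1Sections.restrict {U V : Opens Y} (h : V ≤ U) (s : Gamma1Sections p U) :
    Gamma1Sections p V :=
  ⟨s.1.comp (ContinuousMap.inclusion h), by
    obtain ⟨D, hD, hdense, hs⟩ := s.2
    refine ⟨D ⊓ V, inf_le_right, fun x hx => ?_, fun x hx => hs x hx.1⟩
    rw [mem_closure_iff]
    intro O hO hxO
    obtain ⟨y, hy, hyD⟩ := mem_closure_iff.1 (hdense (h hx)) (O ∩ V) (hO.inter V.isOpen) ⟨hxO, hx⟩
    exact ⟨y, hy.1, hyD, hy.2⟩⟩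

/-- The presheaf `Γ¹_p`. -/
def Gamma1 : Presh Y where
  obj U := Gamma1Sections p U.unop.1
  map {_ _} f := ↾(Gamma1Sections.restrict p (leOfHom f.unop))
  map_id _ := rfl
  map_comp _ _ := rfl

end Gamma

/-! ### The stonean sheafification -/

/-- The stonean sheafification `Γ¹(Λ¹(ℱ))`, a presheaf on `St(RO(X))`. -/
def stoneanSheafify {X : Type u} [TopologicalSpace X] (F : Presh X) : Presh (St (RO X)) :=
  Gamma1 (Lambda1.proj : Lambda1 F → St (RO X))

/-- The stonean sheafification, as an object of `Presh*(Set)`. -/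
def sheafifyObj (F : PreshStar.{u}) : PreshStar.{u} where
  space := St (RO F.space)
  dense := St.roDense _
  presheaf := stoneanSheafify F.presheaf

section Maps

variable {X Y : Type u} [TopologicalSpace X] [TopologicalSpace Y]

theorem ne_bot_of_mem (i : CompleteHom (RO X) (RO Y)) {U : RO X} {G : St (RO Y)} (h : i U ∈ G) :
    i U ≠ ⊥ := fun e => G.bot_notMem (e ▸ h)

theorem reg_mem_of_mem {U : RO Y} {G : St (RO Y)} (h : U ∈ G) : reg (U : Opens Y) ∈ G := by
  rwa [show reg (U : Opens Y) = U from Heyting.Regular.toRegular_coe U]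

theorem pushOpen_image_le (i : CompleteHom (RO X) (RO Y)) (U : ROpos X) (h : i U.1 ≠ ⊥) :
    (pushOpen i).obj ((inclRO Y).obj ⟨i U.1, h⟩) ≤ (inclRO X).obj U := by
  change pi i (reg ((i U.1 : RO Y) : Opens Y)) ≤ U.1
  rw [show reg ((i U.1 : RO Y) : Opens Y) = i U.1 from Heyting.Regular.toRegular_coe _]
  exact (pi_gc i).l_u_le U.1

end Maps

/-- `b = (i¹, Θ¹)` is the image under `Γ¹ ∘ Λ¹` of the morphism `a = (i, Θ) : ℱ₀ → ℱ₁`: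

* `i¹` is `W ↦ (π*_i)⁻¹[W]` (so that `N_U ↦ N_{i(U)}`);
* `Θ¹` maps a section `s` of `Γ¹(Λ¹(ℱ₀))` over `π_{i¹}(Reg A)` to the section over `A` obtained by
  composing `s` with `π*_i` and applying the map `Λ¹(Θ)` between the stalks,
  `[f]_{π*_i(G)} ↦ [Θ_{i(U)}(f ↾ π_i(i(U)))]_G` for `f ∈ ℱ₀(U)`, `U` regular open, `i(U) ∈ G`. -/
structure IsSheafifiedMap {F₀ F₁ : PreshStar.{u}} (a : F₀.Hom F₁)
    (b : (sheafifyObj F₀).Hom (sheafifyObj F₁)) : Prop where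
  hom_eq : ∀ (W : RO (St (RO F₀.space))) (G : St (RO F₁.space)),
    G ∈ Heyting.Regular.val (b.hom W) ↔ piStar a.hom G ∈ Heyting.Regular.val W
  trans_eq : ∀ (A : NOpens (St (RO F₁.space)))
    (s : Gamma1Sections (Lambda1.proj (F := F₀.presheaf)) ((pushOpen b.hom).obj A).1)
    (G : St (RO F₁.space)) (hG : G ∈ A.1) (hG' : piStar a.hom G ∈ ((pushOpen b.hom).obj A).1)
    (U : ROpos F₀.space) (hU : a.hom U.1 ∈ G) (f : F₀.presheaf.obj (op ((inclRO F₀.space).obj U))),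
    s.1 ⟨piStar a.hom G, hG'⟩ =
        ((dot f (piStar a.hom G) (reg_mem_of_mem hU) : Lambda1 F₀.presheaf) :
          OnePoint (Lambda1 F₀.presheaf)) →
      (show Gamma1Sections (Lambda1.proj (F := F₁.presheaf)) A.1 from b.trans.app (op A) s).1
          ⟨G, hG⟩ =
        ((dot (U := (inclRO F₁.space).obj ⟨a.hom U.1, ne_bot_of_mem a.hom hU⟩)
          (a.trans.app (op ((inclRO F₁.space).obj ⟨a.hom U.1, ne_bot_of_mem a.hom hU⟩))
            (F₀.presheaf.map
              (homOfLE (pushOpen_image_le a.hom U (ne_bot_of_mem a.hom hU))).op f))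
          G (reg_mem_of_mem hU) : Lambda1 F₁.presheaf) : OnePoint (Lambda1 F₁.presheaf))

end StoneanSheafification

open StoneanSheafification

/-! The Boolean part of the construction changes nothing: in the Stone space of a complete Boolean
algebra the closure of an open set is some `N_b`, so the space is extremally disconnected and `U ↦
N_U` is an isomorphism of `RO X` with `RO (St (RO X))` (`nRegIso`). What remains concerns sections.

Germs are governed by the Boolean truth value `eqReg f g` of `f = g`: the germs at an ultrafilter
coincide exactly when the ultrafilter contains this value (`germRel_iff`). Hence germ maps are
continuous on clopen sets, `Λ¹` is locally compact Hausdorff, and its one-point compactification is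
compact Hausdorff. Sections agreeing on a dense set are then equal, and a continuous map on a dense
open set extends by extremal disconnectedness (`exists_extension_of_dense`); this is the dense sheaf
property.

The unit sends `f` to the section of its germs. When regular open sets are dense, every section is
of this form over densely many `N_q` (`Sec.exists_eq_dotSec`). A morphism into a dense sheaf is
therefore determined by its composite with the unit. Conversely, a morphism `a` out of `ℱ`
prescribes values `a(f)` on a dense family. They do not depend on the representative `f`, because a
dense sheaf identifies the images of sections with large enough truth value (`act_eq_of_le_eqReg`),
so they glue (`exists_trans`).

Finally, the germ formula for the action on morphisms is equivalent to commutation of the square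
with the two units (`isSheafifiedMap_of_comm`, `IsSheafifiedMap.comm`). Existence, uniqueness,
functoriality and the adjunction follow formally from the universal property. -/

namespace StoneanSheafification

/-! ### Stone spaces of complete Boolean algebras -/

section Stone

variable {B : Type u} [BooleanAlgebra B]

theorem St.mem_N {b : B} {G : St B} : G ∈ St.N b ↔ b ∈ G := Iff.rfl

theorem St.compl_mem_iff {b : B} {G : St B} : bᶜ ∈ G ↔ b ∉ G := by
  rw [← St.mem_N, ← St.compl_N]
  rfl

theorem St.inf_mem_iff {a b : B} {G : St B} : a ⊓ b ∈ G ↔ a ∈ G ∧ b ∈ G :=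
  ⟨fun h => ⟨G.mem_of_le h inf_le_left, G.mem_of_le h inf_le_right⟩, fun h => G.inf_mem h.1 h.2⟩

theorem St.isClosed_N (b : B) : IsClosed (St.N b) := by
  rw [← isOpen_compl_iff, St.compl_N]
  exact St.isOpen_N _

/-- The prime ideal theorem separates the filter above `b` from the zero ideal; the complement of
the resulting prime ideal is an ultrafilter. -/
theorem St.exists_mem {b : B} (hb : b ≠ ⊥) : ∃ G : St B, b ∈ G := by
  have hd : Disjoint ((Order.PFilter.principal b : Order.PFilter B) : Set B)
      ((Order.Ideal.principal ⊥ : Order.Ideal B) : Set B) := by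
    rw [Set.disjoint_left]
    intro c hc hc'
    exact hb (le_bot_iff.1 (le_trans (show b ≤ c from hc) (show c ≤ ⊥ from hc')))
  obtain ⟨J, hJ, -, hJb⟩ := DistribLattice.prime_ideal_of_disjoint_filter_ideal hd
  have hbJ : b ∉ J := fun h => Set.disjoint_left.1 hJb (show b ≤ b from le_rfl) h
  refine ⟨⟨{c | c ∉ J}, fun h => hbJ (J.lower le_top h), fun h => h J.bot_mem,
    fun ha hab hb => ha (J.lower hab hb), fun ha hb hab => ?_, fun c => ?_⟩, hbJ⟩
  · exact (hJ.mem_or_mem hab).elim ha hb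
  · by_contra! h
    simp only [Set.mem_ofPred_eq, not_not] at h
    refine hbJ (J.lower le_top ?_)
    rw [← sup_compl_eq_top (x := c)]
    exact J.sup_mem h.1 h.2

theorem St.N_subset_iff {a b : B} : St.N a ⊆ St.N b ↔ a ≤ b := by
  refine ⟨fun h => ?_, fun h G hG => G.mem_of_le hG h⟩
  by_contra hab
  obtain ⟨G, hG⟩ := St.exists_mem (b := a ⊓ bᶜ) fun e => hab (by
    rwa [← disjoint_iff, disjoint_compl_right_iff] at e)
  rw [St.inf_mem_iff, St.compl_mem_iff] at hG
  exact hG.2 (h hG.1)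

theorem St.exists_N_subset {U : Set (St B)} (hU : IsOpen U) {G : St B} (hG : G ∈ U) :
    ∃ b ∈ G, St.N b ⊆ U := by
  obtain ⟨_, ⟨b, rfl⟩, hb, hbU⟩ := St.isTopologicalBasis.exists_subset_of_mem_open hG hU
  exact ⟨b, hb, hbU⟩

/-- An ultrafilter `𝒰` of subsets of the Stone space converges to the point `{b | St.N b ∈ 𝒰}`. -/
instance St.compactSpace : CompactSpace (St B) where
  isCompact_univ := by
    rw [isCompact_iff_ultrafilter_le_nhds]
    intro 𝒰 _
    refine ⟨⟨{b | St.N b ∈ 𝒰}, ?_, ?_, ?_, ?_, ?_⟩, trivial, ?_⟩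
    · rw [Set.mem_ofPred_eq, show St.N (⊤ : B) = Set.univ from Set.eq_univ_of_forall fun G => G.top_mem]
      exact Filter.univ_mem
    · rw [Set.mem_ofPred_eq, show St.N (⊥ : B) = ∅ from
        Set.eq_empty_of_forall_notMem fun G => G.bot_notMem]
      exact 𝒰.empty_notMem
    · intro a b ha hab
      exact Filter.mem_of_superset ha (St.N_subset_iff.2 hab)
    · intro a b ha hb
      exact Filter.mem_of_superset (Filter.inter_mem ha hb) fun G hG => G.inf_mem hG.1 hG.2
    · intro a
      change _ ∨ St.N aᶜ ∈ 𝒰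
      rw [← St.compl_N]
      exact 𝒰.mem_or_compl_mem _
    · intro S hS
      obtain ⟨U, hUS, hU, hGU⟩ := mem_nhds_iff.1 hS
      obtain ⟨b, hb, hbU⟩ := St.exists_N_subset hU hGU
      exact Filter.mem_of_superset hb (hbU.trans hUS)

theorem St.exists_mem_compl_mem {G H : St B} (h : G ≠ H) : ∃ b, b ∈ G ∧ bᶜ ∈ H := by
  by_contra! hc
  apply h
  have key : ∀ b, b ∈ G → b ∈ H := fun b hb => (H.mem_or_compl_mem b).resolve_right (hc b hb)
  apply St.ext
  ext b
  refine ⟨key b, fun hb => ?_⟩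
  by_contra hbG
  exact St.compl_mem_iff.1 (key _ (St.compl_mem_iff.2 hbG)) hb

instance St.t2Space : T2Space (St B) where
  t2 G H h := by
    obtain ⟨b, hb, hb'⟩ := St.exists_mem_compl_mem h
    refine ⟨_, _, St.isOpen_N b, St.isOpen_N bᶜ, hb, hb', ?_⟩
    rw [← St.compl_N]
    exact disjoint_compl_right

/-- `N_b` is closed and contains every basic subset of `W`. If a basic set `N_d` misses `W`, then
`dᶜ` is an upper bound, so `b ≤ dᶜ` and `N_d` misses `N_b`. -/
theorem St.closure_eq_N {W : Set (St B)} {b : B} (hW : IsOpen W)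
    (hb : IsLUB {c | St.N c ⊆ W} b) : closure W = St.N b := by
  apply Set.Subset.antisymm
  · refine closure_minimal (fun G hG => ?_) (St.isClosed_N b)
    obtain ⟨c, hc, hcW⟩ := St.exists_N_subset hW hG
    exact G.mem_of_le hc (hb.1 hcW)
  · intro G hG
    rw [mem_closure_iff]
    intro O hO hGO
    obtain ⟨d, hd, hdO⟩ := St.exists_N_subset hO hGO
    by_contra hne
    have hbd : b ≤ dᶜ := hb.2 fun c hc => by
      rw [← St.N_subset_iff, ← St.compl_N]
      exact fun H hH hHd => hne ⟨H, hdO hHd, hc hH⟩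
    exact St.compl_mem_iff.1 (G.mem_of_le hG hbd) hd

theorem reg_mono {X : Type u} [TopologicalSpace X] {U V : Opens X} (h : U ≤ V) : reg U ≤ reg V :=
  Heyting.Regular.toRegular.monotone h

theorem reg_coe {X : Type u} [TopologicalSpace X] (U : RO X) : reg (U : Opens X) = U :=
  Heyting.Regular.toRegular_coe U

theorem le_reg {X : Type u} [TopologicalSpace X] (U : Opens X) : U ≤ (reg U : RO X) :=
  le_compl_compl

theorem reg_le_iff {X : Type u} [TopologicalSpace X] {U : Opens X} {V : RO X} :
    reg U ≤ V ↔ U ≤ (V : Opens X) :=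
  Heyting.Regular.gi.gc U V

theorem isLUB_RO {X : Type u} [TopologicalSpace X] (A : Set (RO X)) :
    IsLUB A (reg (sSup ((↑) '' A) : Opens X)) := by
  constructor
  · intro a ha
    rw [← reg_coe a]
    exact reg_mono (le_sSup ⟨_, ha, rfl⟩)
  · intro d hd
    rw [reg_le_iff]
    refine sSup_le ?_
    rintro _ ⟨b, hb, rfl⟩
    exact hd hb

instance St.extremallyDisconnected {X : Type u} [TopologicalSpace X] :
    ExtremallyDisconnected (St (RO X)) where
  open_closure U hU := by
    rw [St.closure_eq_N hU (isLUB_RO _)]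
    exact St.isOpen_N _

/-- The basic clopen set `N_b`, as a regular open set. -/
def nReg (b : B) : RO (St B) := ⟨⟨St.N b, St.isOpen_N b⟩, St.isRegular_N b⟩

theorem nReg_le_iff {a b : B} : nReg a ≤ nReg b ↔ a ≤ b := St.N_subset_iff

/-- Closures of open sets are open here, so a regular open set equals its closure, which is some
`N_b`. -/
theorem nReg_surjective {X : Type u} [TopologicalSpace X] :
    Function.Surjective (nReg : RO X → RO (St (RO X))) := by
  intro W
  refine ⟨_, Heyting.Regular.coe_injective (SetLike.coe_injective
    ((St.closure_eq_N (Heyting.Regular.val W).isOpen (isLUB_RO _)).symm.trans ?_))⟩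
  have h := coe_reg (W : Opens (St (RO X)))
  rw [reg_coe] at h
  exact (h.trans (ExtremallyDisconnected.open_closure _
    (Heyting.Regular.val W).isOpen).interior_eq).symm

/-- The canonical isomorphism of `RO(X)` with the regular open sets of its Stone space. -/
noncomputable def nRegIso (X : Type u) [TopologicalSpace X] : RO X ≃o RO (St (RO X)) :=
  RelIso.ofSurjective (OrderEmbedding.ofMapLEIff nReg fun _ _ => nReg_le_iff) nReg_surjective

/-- An order isomorphism, as a complete homomorphism. -/
def CompleteHom.ofOrderIso {C : Type u} [BooleanAlgebra C] (e : B ≃o C) : CompleteHom B C where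
  toFun := e
  map_sup' := map_sup e
  map_inf' := map_inf e
  map_top' := map_top e
  map_bot' := map_bot e
  map_isLUB _ _ h := e.isLUB_image'.2 h

theorem CompleteHom.mono {C : Type u} [BooleanAlgebra C] (i : CompleteHom B C) : Monotone i :=
  OrderHomClass.mono i.toBoundedLatticeHom

theorem CompleteHom.map_compl {C : Type u} [BooleanAlgebra C] (i : CompleteHom B C) (a : B) :
    i aᶜ = (i a)ᶜ :=
  map_compl' i.toBoundedLatticeHom a

theorem CompleteHom.ext_fun {C : Type u} [BooleanAlgebra C] {i j : CompleteHom B C}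
    (h : ∀ b, i b = j b) : i = j :=
  CompleteHom.ext (funext h)

end Stone

/-- The complete homomorphism `U ↦ N_U` from `RO(X)` to `RO(St(RO(X)))`. -/
noncomputable def unitHom (X : Type u) [TopologicalSpace X] :
    CompleteHom (RO X) (RO (St (RO X))) :=
  CompleteHom.ofOrderIso (nRegIso X)

/-- The inverse of `U ↦ N_U`. -/
noncomputable def unitHomInv (X : Type u) [TopologicalSpace X] :
    CompleteHom (RO (St (RO X))) (RO X) :=
  CompleteHom.ofOrderIso (nRegIso X).symm

theorem unitHomInv_nReg {X : Type u} [TopologicalSpace X] (b : RO X) :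
    unitHomInv X (nReg b) = b :=
  (nRegIso X).symm_apply_apply b

/-! ### The adjunction between `π_i` and `i` on nonempty open sets -/

section PushOpen

variable {X Y : Type u} [TopologicalSpace X] [TopologicalSpace Y]

/-- The regular open set `π_i(Reg A)`. -/
def piReg (i : CompleteHom (RO X) (RO Y)) (A : NOpens Y) : RO X := pi i (reg A.1)

theorem piReg_le_iff {i : CompleteHom (RO X) (RO Y)} {A : NOpens Y} {b : RO X} :
    piReg i A ≤ b ↔ A.1 ≤ (i b : Opens Y) :=
  (pi_gc i _ b).trans reg_le_iff

theorem le_piReg (i : CompleteHom (RO X) (RO Y)) (A : NOpens Y) :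
    A.1 ≤ (i (piReg i A) : Opens Y) :=
  piReg_le_iff.1 le_rfl

theorem pushOpen_le_iff {i : CompleteHom (RO X) (RO Y)} {A : NOpens Y} {U : ROpos X} :
    (pushOpen i).obj A ≤ (inclRO X).obj U ↔ A.1 ≤ (i U.1 : Opens Y) :=
  piReg_le_iff

/-- If `0 ≠ b ≤ π_i(Reg A)`, then `i(b)` meets `A`. -/
theorem inter_nonempty_of_le_piReg {i : CompleteHom (RO X) (RO Y)} {A : NOpens Y} {b : RO X}
    (hb : b ≠ ⊥) (hbA : b ≤ piReg i A) : ((A.1 ⊓ (i b : Opens Y) : Opens Y) : Set Y).Nonempty := by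
  by_contra h
  -- Disjointness of `A` from `i(b)` reads `A ⊆ i(bᶜ)`, which the adjunction turns into a bound on
  -- `π_i(Reg A)`.
  have h1 : piReg i A ≤ bᶜ := by
    rw [piReg_le_iff, i.map_compl]
    change A.1 ≤ (i b : Opens Y)ᶜ
    rw [le_compl_iff_disjoint_right, disjoint_iff]
    ext x
    exact ⟨fun hx => (h ⟨x, hx⟩).elim, fun hx => hx.elim⟩
  have h2 := hbA.trans h1
  rw [le_compl_self] at h2
  exact hb h2

end PushOpen

/-! ### The topology of `Λ¹` -/

section Bundle

variable {X : Type u} [TopologicalSpace X] {F : Presh X}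

/-- Restriction of sections of a presheaf. -/
def res {U V : NOpens X} (h : V ≤ U) (f : F.obj (op U)) : F.obj (op V) := F.map (homOfLE h).op f

theorem res_res {U V W : NOpens X} (h : V ≤ U) (h' : W ≤ V) (f : F.obj (op U)) :
    res h' (res h f) = res (h'.trans h) f := by
  unfold res
  rw [← ConcreteCategory.comp_apply, ← F.map_comp]
  rfl

theorem res_self {U : NOpens X} (h : U ≤ U) (f : F.obj (op U)) : res h f = f := by
  unfold res
  rw [show (homOfLE h).op = 𝟙 (op U) from rfl, F.map_id]
  rfl

theorem inf_nonempty_of_le_reg {W : NOpens X} {E : Opens X} (h : W.1 ≤ (reg E : Opens X)) :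
    ((W.1 ⊓ E : Opens X) : Set X).Nonempty := by
  by_contra hne
  have h1 : W.1 ≤ Eᶜ := by
    rw [le_compl_iff_disjoint_right, disjoint_iff]
    ext x
    exact ⟨fun hx => (hne ⟨x, hx⟩).elim, fun hx => hx.elim⟩
  obtain ⟨x, hx⟩ := W.2
  have h2 : x ∈ (Eᶜ ⊓ Eᶜᶜ : Opens X) := ⟨h1 hx, h hx⟩
  rw [inf_compl_self] at h2
  exact h2

/-- The largest open set on which `f` and `g` agree locally. -/
def eqOpen {U V : NOpens X} (f : F.obj (op U)) (g : F.obj (op V)) : Opens X :=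
  sSup {W | ∃ (h : (W : Set X).Nonempty) (hU : (⟨W, h⟩ : NOpens X) ≤ U)
    (hV : (⟨W, h⟩ : NOpens X) ≤ V), res hU f = res hV g}

/-- The Boolean truth value of `f = g`. -/
def eqReg {U V : NOpens X} (f : F.obj (op U)) (g : F.obj (op V)) : RO X := reg (eqOpen f g)

theorem le_eqReg {U V W : NOpens X} {f : F.obj (op U)} {g : F.obj (op V)} (hU : W ≤ U) (hV : W ≤ V)
    (h : res hU f = res hV g) : reg W.1 ≤ eqReg f g :=
  reg_mono (le_sSup ⟨W.2, hU, hV, h⟩)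

theorem exists_res_eq {U V W : NOpens X} {f : F.obj (op U)} {g : F.obj (op V)}
    (hW : W.1 ≤ (eqReg f g : Opens X)) :
    ∃ (W' : NOpens X) (_ : W' ≤ W) (hU : W' ≤ U) (hV : W' ≤ V), res hU f = res hV g := by
  obtain ⟨x, hxW, hx⟩ := inf_nonempty_of_le_reg hW
  obtain ⟨E, ⟨hE, hU, hV, h⟩, hxE⟩ := Opens.mem_sSup.1 hx
  have h1 : (⟨W.1 ⊓ E, ⟨x, hxW, hxE⟩⟩ : NOpens X) ≤ ⟨E, hE⟩ := (inf_le_right : W.1 ⊓ E ≤ E)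
  refine ⟨⟨W.1 ⊓ E, ⟨x, hxW, hxE⟩⟩, (inf_le_left : W.1 ⊓ E ≤ W.1), h1.trans hU, h1.trans hV, ?_⟩
  rw [← res_res hU h1, h, res_res]

/-- Agreement on a dense family below `U` forces `Reg U ≤ eqReg f g`, since `U` cannot meet the
complement of `eqOpen f g`. Conversely, `eqOpen f g` itself serves as the witness `U`. -/
theorem germRel_iff {G : St (RO X)} {f g : PreGerm F G} :
    GermRel F G f g ↔ eqReg f.2 g.2 ∈ G := by
  constructor
  · rintro ⟨U, hf, hg, hU, h⟩
    refine G.mem_of_le hU ?_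
    by_contra hle
    have hne : ((U.1 ⊓ (eqOpen f.2 g.2)ᶜ : Opens X) : Set X).Nonempty := by
      by_contra hE
      apply hle
      rw [reg_le_iff]
      change U.1 ≤ (eqOpen f.2 g.2)ᶜᶜ
      rw [le_compl_iff_disjoint_right, disjoint_iff]
      ext x
      exact ⟨fun hx => (hE ⟨x, hx⟩).elim, fun hx => hx.elim⟩
    obtain ⟨V, hV, e⟩ := h ⟨_, hne⟩ (inf_le_left : U.1 ⊓ (eqOpen f.2 g.2)ᶜ ≤ U.1)
    obtain ⟨x, hx⟩ := V.2
    have hx' : x ∈ (eqOpen f.2 g.2 ⊓ (eqOpen f.2 g.2)ᶜ : Opens X) :=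
      ⟨Opens.mem_sSup.2 ⟨V.1, ⟨V.2, _, _, e⟩, hx⟩, (hV hx).2⟩
    rw [inf_compl_self] at hx'
    exact hx'
  · intro h
    have hne : ((eqOpen f.2 g.2 : Opens X) : Set X).Nonempty := by
      by_contra hE
      apply G.bot_notMem
      have e : eqOpen f.2 g.2 = ⊥ := by
        ext x
        exact ⟨fun hx => (hE ⟨x, hx⟩).elim, fun hx => hx.elim⟩
      rw [eqReg, e, show reg (⊥ : Opens X) = ⊥ from Heyting.Regular.toRegular_coe ⊥] at h
      exact h
    refine ⟨⟨_, hne⟩, (sSup_le fun _ h => h.2.1 : eqOpen f.2 g.2 ≤ f.1.1.1),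
      (sSup_le fun _ h => h.2.2.1 : eqOpen f.2 g.2 ≤ g.1.1.1), h, fun W hW => ?_⟩
    obtain ⟨V, hV, _, _, e⟩ := exists_res_eq (W := W) (f := f.2) (g := g.2)
      (le_trans (show W.1 ≤ _ from hW) (le_reg _))
    exact ⟨V, hV, e⟩

theorem dot_eq_dot_iff {U V : NOpens X} {f : F.obj (op U)} {g : F.obj (op V)} {G : St (RO X)}
    {hU : reg U.1 ∈ G} {hV : reg V.1 ∈ G} : dot f G hU = dot g G hV ↔ eqReg f g ∈ G := by
  constructor
  · intro h
    have h1 := eq_of_heq (Lambda1.mk.inj h).2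
    have h2 : GermRel F G ⟨⟨U, hU⟩, f⟩ ⟨⟨V, hV⟩, g⟩ := Quotient.exact h1
    exact (germRel_iff (f := ⟨⟨U, hU⟩, f⟩) (g := ⟨⟨V, hV⟩, g⟩)).1 h2
  · intro h
    have h2 : GermRel F G ⟨⟨U, hU⟩, f⟩ ⟨⟨V, hV⟩, g⟩ :=
      (germRel_iff (f := ⟨⟨U, hU⟩, f⟩) (g := ⟨⟨V, hV⟩, g⟩)).2 h
    exact congrArg (Lambda1.mk G) (Quotient.sound h2)

theorem dot_res {U V : NOpens X} (h : V ≤ U) (f : F.obj (op U)) {G : St (RO X)}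
    (hG : reg V.1 ∈ G) : dot (res h f) G hG = dot f G (G.mem_of_le hG (reg_mono h)) := by
  rw [dot_eq_dot_iff]
  refine G.mem_of_le hG (le_eqReg le_rfl h ?_)
  rw [res_res]

theorem exists_eq_dot (e : Lambda1 F) :
    ∃ (U : NOpens X) (f : F.obj (op U)) (hU : reg U.1 ∈ e.proj), e = dot f e.proj hU := by
  obtain ⟨G, e⟩ := e
  obtain ⟨⟨⟨U, hU⟩, f⟩, rfl⟩ := Quotient.exists_rep e
  exact ⟨U, f, hU, rfl⟩

/-- The set of the germs `[f]_G` with `q ∈ G`. -/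
def dotSet {U : NOpens X} (f : F.obj (op U)) (q : RO X) : Set (Lambda1 F) :=
  {e | ∃ (hU : reg U.1 ∈ e.proj), q ∈ e.proj ∧ e = dot f e.proj hU}

theorem isOpen_dotSet {U : NOpens X} (f : F.obj (op U)) {q : RO X} :
    IsOpen (dotSet f q) := by
  -- The generating sets require `q ⊆ Reg U`, whereas `dotSet` allows any `q`; hence the meet.
  refine isOpen_generateFrom_of_mem ⟨U, f, q ⊓ reg U.1, inf_le_right, ?_⟩
  ext e
  constructor
  · rintro ⟨hU, hq, he⟩
    exact ⟨e.proj, St.inf_mem_iff.2 ⟨hq, hU⟩, he⟩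
  · rintro ⟨G, hG, rfl⟩
    exact ⟨_, (St.inf_mem_iff.1 hG).1, rfl⟩

theorem dot_mem_dotSet {U : NOpens X} (f : F.obj (op U)) {q : RO X} {G : St (RO X)}
    (hU : reg U.1 ∈ G) (hq : q ∈ G) : dot f G hU ∈ dotSet f q := ⟨hU, hq, rfl⟩

theorem continuous_proj : Continuous (Lambda1.proj : Lambda1 F → St (RO X)) := by
  refine continuous_generateFrom_iff.2 ?_
  rintro _ ⟨b, rfl⟩
  have : (Lambda1.proj ⁻¹' St.N b : Set (Lambda1 F)) =
      ⋃ (U : NOpens X) (f : F.obj (op U)), dotSet f b := by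
    ext e
    simp only [Set.mem_iUnion]
    constructor
    · intro h
      obtain ⟨U, f, hU, he⟩ := exists_eq_dot e
      exact ⟨U, f, hU, h, he⟩
    · rintro ⟨U, f, -, h, -⟩
      exact h
  rw [this]
  exact isOpen_iUnion fun U => isOpen_iUnion fun f => isOpen_dotSet f

/-- The generating set given by `g` and `q` pulls back to the trace of `N_{q ⊓ eqReg f g}`. -/
theorem continuous_dot {U : NOpens X} (f : F.obj (op U)) :
    Continuous fun G : St.N (reg U.1) => dot f G.1 G.2 := by
  refine continuous_generateFrom_iff.2 ?_
  rintro _ ⟨V, g, q, hq, rfl⟩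
  convert (St.isOpen_N (q ⊓ eqReg f g)).preimage continuous_subtype_val using 1
  ext ⟨G, hG⟩
  constructor
  · rintro ⟨G', hG', h⟩
    obtain rfl : G = G' := congrArg Lambda1.proj h
    exact St.inf_mem_iff.2 ⟨hG', dot_eq_dot_iff.1 h⟩
  · intro h
    obtain ⟨h1, h2⟩ := St.inf_mem_iff.1 h
    exact ⟨G, h1, dot_eq_dot_iff.2 h2⟩

/-- The image of the compact set `N_{Reg U}` under the germ map of `f` is a compact neighbourhood of
each of its points. Together with the Hausdorff property this makes the one-point compactification
Hausdorff. -/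
instance : WeaklyLocallyCompactSpace (Lambda1 F) where
  exists_compact_mem_nhds e := by
    obtain ⟨U, f, hU, he⟩ := exists_eq_dot e
    have : CompactSpace (St.N (reg U.1)) :=
      isCompact_iff_compactSpace.1 (St.isClosed_N _).isCompact
    refine ⟨_, isCompact_range (continuous_dot f),
      Filter.mem_of_superset ((isOpen_dotSet f (q := ⊤)).mem_nhds ⟨hU, e.proj.top_mem, he⟩) ?_⟩
    rintro e' ⟨hU', -, he'⟩
    exact ⟨⟨e'.proj, hU'⟩, he'.symm⟩

/-- Distinct germs over one point are separated by the complement of the truth value of `f = g`;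
germs over distinct points are separated by the projection. -/
instance : T2Space (Lambda1 F) where
  t2 e e' hne := by
    by_cases hp : e.proj = e'.proj
    · obtain ⟨U, f, hU, he⟩ := exists_eq_dot e
      obtain ⟨V, g, hV, he'⟩ := exists_eq_dot e'
      have h : (eqReg f g)ᶜ ∈ e.proj := by
        rw [St.compl_mem_iff]
        intro h
        apply hne
        obtain ⟨G, e⟩ := e
        obtain ⟨G', e'⟩ := e'
        obtain rfl : G = G' := hp
        rw [he, he']
        exact dot_eq_dot_iff.2 h
      refine ⟨_, _, isOpen_dotSet f, isOpen_dotSet g, ⟨hU, h, he⟩, ⟨hV, hp ▸ h, he'⟩, ?_⟩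
      rw [Set.disjoint_left]
      rintro x ⟨hU, hx, hx1⟩ ⟨hV, -, hx2⟩
      exact St.compl_mem_iff.1 hx (dot_eq_dot_iff.1 (hx1.symm.trans hx2))
    · obtain ⟨U, V, hU, hV, heU, heV, hd⟩ := t2_separation hp
      exact ⟨_, _, hU.preimage continuous_proj, hV.preimage continuous_proj, heU, heV,
        hd.preimage _⟩

/-! ### Sections of `Γ¹(Λ¹)` -/

variable (F) in
/-- The sections of the sheafification. -/
abbrev Sec (A : Opens (St (RO X))) : Type u := Gamma1Sections (Lambda1.proj (F := F)) A

/-- The value of a section at a point. -/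
def Sec.val {A : Opens (St (RO X))} (s : Sec F A) (G : St (RO X)) (hG : G ∈ A) :
    OnePoint (Lambda1 F) := s.1 ⟨G, hG⟩

/-- `Λ¹` is open in its one-point compactification, so the values of `s` stay in `S` near any point
where they lie in `S`. -/
theorem exists_eq_of_open {A : Opens (St (RO X))} (s : C(A, OnePoint (Lambda1 F)))
    {S : Set (Lambda1 F)} (hS : IsOpen S) {e : Lambda1 F} (he : e ∈ S) {G : St (RO X)} (hG : G ∈ A)
    (hs : s ⟨G, hG⟩ = (e : OnePoint (Lambda1 F))) {b : RO X} (hb : b ∈ G) :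
    ∃ q ∈ G, q ≤ b ∧ ∃ hq : St.N q ⊆ A, ∀ H (hH : q ∈ H), ∃ e' ∈ S,
      s ⟨H, hq hH⟩ = (e' : OnePoint (Lambda1 F)) := by
  have ho : IsOpen (s ⁻¹' (OnePoint.some '' S)) :=
    (OnePoint.isOpenEmbedding_coe.isOpenMap _ hS).preimage s.continuous
  have ho' := (A.isOpen.isOpenMap_subtype_val _ ho).inter (St.isOpen_N b)
  obtain ⟨q, hq, hqA⟩ := St.exists_N_subset ho' (G := G)
    ⟨⟨⟨G, hG⟩, ⟨e, he, hs.symm⟩, rfl⟩, hb⟩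
  refine ⟨q, hq, St.N_subset_iff.1 (hqA.trans Set.inter_subset_right), fun H hH => ?_,
    fun H hH => ?_⟩
  · obtain ⟨⟨⟨H', hH'⟩, -, rfl⟩, -⟩ := hqA hH
    exact hH'
  · obtain ⟨⟨⟨H', hH'⟩, ⟨e', he', h⟩, rfl⟩, -⟩ := hqA hH
    exact ⟨e', he', h.symm⟩

/-- The section condition is imposed only on a dense set, but it propagates to every point with a
finite value: were the projection different from `G`, it would be separated from the base point on a
whole neighbourhood of `G`, which meets the dense set. -/
theorem Sec.proj_eq {A : Opens (St (RO X))} (s : Sec F A) {G : St (RO X)} (hG : G ∈ A)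
    {e : Lambda1 F} (h : s.val G hG = (e : OnePoint (Lambda1 F))) : e.proj = G := by
  by_contra hne
  obtain ⟨b, hb, hb'⟩ := St.exists_mem_compl_mem hne
  obtain ⟨q, hqG, hqb, hqA, hq⟩ := exists_eq_of_open s.1
    ((St.isOpen_N b).preimage continuous_proj) hb hG h hb'
  obtain ⟨D, hD, hdense, hs⟩ := s.2
  obtain ⟨H, hH, hHD⟩ := mem_closure_iff.1 (hdense hG) (St.N q) (St.isOpen_N q) hqG
  obtain ⟨e', he', hse'⟩ := hq H hH
  obtain ⟨e'', hse'', hp⟩ := hs H hHD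
  obtain rfl : e' = e'' := OnePoint.coe_injective (hse'.symm.trans hse'')
  exact St.compl_mem_iff.1 (H.mem_of_le hH hqb) (hp ▸ he')

theorem Sec.exists_eq_dot {A : Opens (St (RO X))} (s : Sec F A) {G : St (RO X)} (hG : G ∈ A)
    {U : NOpens X} (f : F.obj (op U)) (hU : reg U.1 ∈ G)
    (h : s.val G hG = ((dot f G hU : Lambda1 F) : OnePoint (Lambda1 F))) :
    ∃ q ∈ G, ∃ (hqU : q ≤ reg U.1) (hq : St.N q ⊆ A), ∀ H (hH : q ∈ H),
      s.val H (hq hH) = ((dot f H (H.mem_of_le hH hqU) : Lambda1 F) : OnePoint (Lambda1 F)) := by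
  obtain ⟨q, hqG, hqU, hqA, hq⟩ := exists_eq_of_open s.1 (isOpen_dotSet f (q := ⊤))
    (dot_mem_dotSet f hU G.top_mem) hG h hU
  refine ⟨q, hqG, hqU, hqA, fun H hH => ?_⟩
  obtain ⟨e, ⟨hU', -, he⟩, hse⟩ := hq H hH
  obtain rfl := s.proj_eq _ hse
  exact hse.trans (congrArg _ he)

theorem Sec.ext_dense {A : Opens (St (RO X))} {s t : Sec F A}
    (h : ∀ G ∈ A, ∀ b ∈ G, ∃ H, ∃ hH : H ∈ A, b ∈ H ∧ s.val H hH = t.val H hH) : s = t := by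
  apply Subtype.ext
  apply ContinuousMap.ext
  refine congrFun (Continuous.ext_on (s := {x | s.1 x = t.1 x}) ?_ s.1.continuous t.1.continuous
    fun x hx => hx)
  rintro ⟨G, hG⟩
  rw [mem_closure_iff]
  intro O hO hGO
  obtain ⟨b, hb, hbO⟩ := St.exists_N_subset (A.isOpen.isOpenMap_subtype_val _ hO) ⟨_, hGO, rfl⟩
  obtain ⟨H, hH, hbH, e⟩ := h G hG b hb
  obtain ⟨⟨H', hH'⟩, hHO, rfl⟩ := hbO hbH
  exact ⟨_, hHO, e⟩

/-- The section `G ↦ [f]_G`. -/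
def dotSec {U : NOpens X} (f : F.obj (op U)) (A : Opens (St (RO X)))
    (hA : ∀ G ∈ A, reg U.1 ∈ G) : Sec F A :=
  ⟨⟨fun G => ((dot f G.1 (hA _ G.2) : Lambda1 F) : OnePoint (Lambda1 F)),
    OnePoint.continuous_coe.comp ((continuous_dot f).comp
      (continuous_subtype_val.subtype_mk fun G => hA _ G.2))⟩,
    A, le_rfl, subset_closure, fun _ _ => ⟨_, rfl, rfl⟩⟩

/-- A section is, over some basic open set inside any given one, given by an element of `F` over
a regular open set. -/
theorem Sec.exists_eq_dotSec (hX : RODense X) {A : Opens (St (RO X))} (s : Sec F A) {b : RO X}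
    (hb : b ≠ ⊥) (hbA : St.N b ⊆ A) :
    ∃ (q : ROpos X) (_ : q.1 ≤ b) (f : F.obj (op ((inclRO X).obj q))),
      ∀ H (hH : H ∈ A), ∀ hq : q.1 ∈ H,
        s.val H hH = ((dot f H (reg_mem_of_mem hq) : Lambda1 F) : OnePoint (Lambda1 F)) := by
  obtain ⟨G, hG⟩ := St.exists_mem hb
  obtain ⟨D, hD, hdense, hs⟩ := s.2
  obtain ⟨H, hH, hHD⟩ := mem_closure_iff.1 (hdense (hbA hG)) (St.N b) (St.isOpen_N b) hG
  obtain ⟨e, he, rfl⟩ := hs H hHD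
  obtain ⟨U, f, hU, hef⟩ := StoneanSheafification.exists_eq_dot e
  obtain ⟨q, hqG, hqU, hqA, hq⟩ := s.exists_eq_dot _ f hU (he.trans (congrArg _ hef))
  have hqb : q ⊓ b ≠ ⊥ := fun h => e.proj.bot_notMem (h ▸ e.proj.inf_mem hqG hH)
  -- `q` lies below `Reg U` but perhaps not inside `U`, where `f` lives. Since `U` is dense in `Reg
  -- U`, the two meet, and `hX` finds a regular open set in the intersection.
  have hne := inf_nonempty_of_le_reg (W := (inclRO X).obj ⟨q ⊓ b, hqb⟩)
    (le_trans (show q ⊓ b ≤ q from inf_le_left) hqU)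
  obtain ⟨V, hV⟩ := hX ⟨_, hne⟩
  have hVU : (inclRO X).obj V ≤ U := hV.trans inf_le_right
  have hVqb : V.1 ≤ q ⊓ b := hV.trans inf_le_left
  refine ⟨V, hVqb.trans inf_le_right, res hVU f, fun H hH hVH => ?_⟩
  exact (hq H (H.mem_of_le hVH (hVqb.trans inf_le_left))).trans
    (congrArg _ (dot_res hVU f (reg_mem_of_mem hVH)).symm)

end Bundle

/-! ### Dense sheaves -/

section Extension

variable {S K : Type*} [TopologicalSpace S] [TopologicalSpace K]

/-- In an extremally disconnected space, continuous maps to compact Hausdorff spaces extend along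
dense inclusions of open sets. -/
theorem exists_extension_of_dense [ExtremallyDisconnected S] [CompactSpace K] [T2Space K]
    {D U : Opens S} (hDU : D ≤ U) (hd : (U : Set S) ⊆ closure D) (t : C(D, K)) :
    ∃ s : C(U, K), ∀ x (hx : x ∈ D), s ⟨x, hDU hx⟩ = t ⟨x, hx⟩ := by
  let i : D → U := fun x => ⟨x.1, hDU x.2⟩
  have hi : IsDenseInducing i := by
    refine ⟨⟨?_⟩, ?_⟩
    · rw [instTopologicalSpaceSubtype, instTopologicalSpaceSubtype, induced_compose]
      rfl
    · rintro ⟨x, hx⟩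
      rw [mem_closure_iff]
      intro O hO hxO
      obtain ⟨_, ⟨⟨y, hyU⟩, hyO, rfl⟩, hyD⟩ := mem_closure_iff.1 (hd hx) _
        (U.isOpen.isOpenMap_subtype_val _ hO) ⟨_, hxO, rfl⟩
      exact ⟨_, hyO, ⟨y, hyD⟩, rfl⟩
  have hlim : ∀ x, ∃ c, Filter.Tendsto t (Filter.comap i (nhds x)) (nhds c) := by
    intro x
    have := hi.comap_nhds_neBot x
    have hcl : ∀ (c : K), MapClusterPt c (Filter.comap i (nhds x)) t → ∀ A : Set K, IsOpen A →
        c ∈ A → x.1 ∈ closure (Subtype.val '' (t ⁻¹' A)) := by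
      intro c hc A hA hcA
      rw [mem_closure_iff]
      intro O hO hxO
      have h1 := (mapClusterPt_iff_frequently.1 hc) A (hA.mem_nhds hcA)
      have h2 : ∀ᶠ y in Filter.comap i (nhds x), y.1 ∈ O :=
        Filter.preimage_mem_comap ((hO.preimage continuous_subtype_val).mem_nhds hxO)
      obtain ⟨y, hyA, hyO⟩ := (h1.and_eventually h2).exists
      exact ⟨y.1, hyO, y, hyA, rfl⟩
    obtain ⟨c, hc⟩ := exists_clusterPt_of_compactSpace (Filter.map t (Filter.comap i (nhds x)))
    refine ⟨c, tendsto_nhds_of_unique_mapClusterPt fun c' hc' => ?_⟩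
    -- Two cluster values would have disjoint open neighbourhoods, whose preimages are disjoint open
    -- sets. In an extremally disconnected space their closures are disjoint, yet both contain `x`.
    by_contra hne
    obtain ⟨A, B, hA, hB, hcA, hcB, hAB⟩ := t2_separation hne
    refine Set.disjoint_left.1 (ExtremallyDisconnected.disjoint_closure_of_disjoint_isOpen
      (U₁ := Subtype.val '' (t ⁻¹' A)) (U₂ := Subtype.val '' (t ⁻¹' B)) ?_ ?_ ?_)
      (hcl c' hc' A hA hcA) (hcl c hc B hB hcB)
    · exact Set.disjoint_image_of_injective Subtype.val_injective (hAB.preimage _)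
    · exact D.isOpen.isOpenMap_subtype_val _ (hA.preimage t.continuous)
    · exact D.isOpen.isOpenMap_subtype_val _ (hB.preimage t.continuous)
  exact ⟨⟨hi.extend t, hi.continuous_extend hlim⟩, fun x hx =>
    hi.extend_eq t.continuous ⟨x, hx⟩⟩

end Extension

/-! ### The sheaf property of the sheafification -/

section Sheaf

variable {X : Type u} [TopologicalSpace X]

theorem stoneanSheafify_map_val (F : Presh X) {A A' : NOpens (St (RO X))} (h : A' ⟶ A)
    (s : Sec F A.1) {G : St (RO X)} (hG : G ∈ A'.1) :
    Sec.val ((stoneanSheafify F).map h.op s : Sec F A'.1) G hG = s.val G (leOfHom h hG) := rfl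

theorem Sec.ext_val {F : Presh X} {A : Opens (St (RO X))} {s t : Sec F A}
    (h : ∀ G hG, s.val G hG = t.val G hG) : s = t :=
  Subtype.ext (ContinuousMap.ext fun x => h x.1 x.2)

/-- The members of a dense sieve have dense union `D` in `A`. This gives separatedness; a compatible
family glues to a continuous map on `D`, which extends to `A`, possibly taking the value at infinity
outside `D`. -/
theorem isDenseSheaf_stoneanSheafify (F : Presh X) : IsDenseSheaf (stoneanSheafify F) := by
  intro A S hS
  rw [← Presieve.isSeparatedFor_and_exists_isAmalgamation_iff_isSheafFor]
  constructor
  · intro x s t hs ht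
    refine Sec.ext_dense (s := s) (t := t) fun G hG b hb => ?_
    have hne : ((A.1 ⊓ ⟨St.N b, St.isOpen_N b⟩ : Opens (St (RO X))) : Set (St (RO X))).Nonempty :=
      ⟨G, hG, hb⟩
    obtain ⟨V, g, hV⟩ := hS (Y := ⟨_, hne⟩) (homOfLE (inf_le_left : A.1 ⊓ _ ≤ A.1))
    obtain ⟨H, hH⟩ := V.2
    refine ⟨H, (leOfHom g hH).1, (leOfHom g hH).2, ?_⟩
    have h := (hs _ hV).trans (ht _ hV).symm
    exact congrArg (fun s : Sec F V.1 => s.val H hH) h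
  · intro x hx
    -- Arrows between open sets are unique, so the cover is indexed by its open sets alone.
    let ι := {V : NOpens (St (RO X)) // ∃ f : V ⟶ A, S f}
    let y : ∀ i : ι, Sec F i.1.1 := fun i => x i.2.choose i.2.choose_spec
    have hy : ∀ (V : NOpens (St (RO X))) (f : V ⟶ A) (hf : S f), x f hf = y ⟨V, f, hf⟩ :=
      fun V f hf => by
        have h : ∀ (g : V ⟶ A) (hg : S g), x f hf = x g hg := by
          intro g hg
          obtain rfl : f = g := Subsingleton.elim _ _
          rfl
        exact h _ _
    let D : Opens (St (RO X)) := ⨆ i : ι, i.1.1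
    have hDA : D ≤ A.1 := iSup_le fun i => leOfHom i.2.choose
    have hAD : (A.1 : Set (St (RO X))) ⊆ closure D := by
      intro G hG
      rw [mem_closure_iff]
      intro O hO hGO
      obtain ⟨V, g, hV⟩ := hS (Y := ⟨A.1 ⊓ ⟨O, hO⟩, G, hG, hGO⟩)
        (homOfLE (inf_le_left : A.1 ⊓ _ ≤ A.1))
      obtain ⟨H, hH⟩ := V.2
      exact ⟨H, (leOfHom g hH).2, Opens.mem_iSup.2 ⟨⟨V, _, hV⟩, hH⟩⟩
    let t : C(D, OnePoint (Lambda1 F)) := ContinuousMap.liftCover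
      (fun i : ι => {x : D | x.1 ∈ i.1.1})
      (fun i => (y i).1.comp ⟨fun z => ⟨z.1.1, z.2⟩, by fun_prop⟩)
      (by
        intro i j z hi hj
        have hne : ((i.1.1 ⊓ j.1.1 : Opens (St (RO X))) : Set (St (RO X))).Nonempty :=
          ⟨z.1, hi, hj⟩
        have h := hx (Z := ⟨_, hne⟩) (homOfLE (inf_le_left : i.1.1 ⊓ j.1.1 ≤ i.1.1))
          (homOfLE (inf_le_right : i.1.1 ⊓ j.1.1 ≤ j.1.1))
          i.2.choose_spec j.2.choose_spec rfl
        exact congrArg (fun s : Sec F (i.1.1 ⊓ j.1.1) => s.val z.1 ⟨hi, hj⟩) h)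
      (by
        intro z
        obtain ⟨i, hi⟩ := Opens.mem_iSup.1 z.2
        exact ⟨i, (i.1.1.isOpen.preimage continuous_subtype_val).mem_nhds hi⟩)
    have ht : ∀ (i : ι) (G : St (RO X)) (hG : G ∈ i.1.1),
        t ⟨G, Opens.mem_iSup.2 ⟨i, hG⟩⟩ = (y i).val G hG := fun i G hG =>
      ContinuousMap.liftCover_coe (S := fun i : ι => {x : D | x.1 ∈ i.1.1}) (i := i)
        ⟨⟨G, Opens.mem_iSup.2 ⟨i, hG⟩⟩, hG⟩
    obtain ⟨s, hs⟩ := exists_extension_of_dense hDA hAD t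
    have hst : ∀ (i : ι) (G : St (RO X)) (hG : G ∈ i.1.1),
        s ⟨G, hDA (Opens.mem_iSup.2 ⟨i, hG⟩)⟩ = (y i).val G hG := fun i G hG =>
      (hs G _).trans (ht i G hG)
    choose E hE hEd hEs using fun i => (y i).2
    refine ⟨⟨s, ⨆ i, E i, iSup_le fun i => (hE i).trans (leOfHom i.2.choose), ?_, ?_⟩, ?_⟩
    · refine hAD.trans (closure_minimal (fun G hG => ?_) isClosed_closure)
      obtain ⟨i, hi⟩ := Opens.mem_iSup.1 hG
      exact closure_mono (le_iSup E i : E i ≤ _) (hEd i hi)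
    · intro G hG
      obtain ⟨i, hi⟩ := Opens.mem_iSup.1 hG
      obtain ⟨e, he, hp⟩ := hEs i G hi
      exact ⟨e, (hst i G (hE i hi)).trans he, hp⟩
    · intro V f hf
      rw [hy V f hf]
      exact Sec.ext_val fun G hG => hst ⟨V, f, hf⟩ G hG

end Sheaf

/-! ### Gluing along dense families -/

section Glue

variable {Y : Type u} [TopologicalSpace Y] {F : Presh Y}

theorem IsDenseSheaf.ext (hF : IsDenseSheaf F) {A : NOpens Y} {s t : F.obj (op A)}
    (h : ∀ C ≤ A, ∃ (D : NOpens Y) (_ : D ≤ C) (hA : D ≤ A), res hA s = res hA t) : s = t := by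
  let S : Sieve A :=
    { arrows := fun V f => res (leOfHom f) s = res (leOfHom f) t
      downward_closed := by
        intro V W f hf g
        rw [← res_res (leOfHom f) (leOfHom g), hf, res_res] }
  have hS : S ∈ (GrothendieckTopology.dense : GrothendieckTopology (NOpens Y)) A := by
    intro V f
    obtain ⟨D, hD, hA, e⟩ := h V (leOfHom f)
    exact ⟨D, homOfLE hD, e⟩
  exact (hF S hS).isSeparatedFor.ext fun V f hf => hf

/-- The open sets where `R` has a value form a dense sieve. Uniqueness of values together with
stability under restriction is exactly compatibility of any chosen family. -/
theorem IsDenseSheaf.exists_glue (hF : IsDenseSheaf F) {A : NOpens Y}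
    (R : ∀ D : NOpens Y, F.obj (op D) → Prop)
    (hR : ∀ D x y, R D x → R D y → x = y)
    (hres : ∀ D D' (h : D' ≤ D) x, R D x → R D' (res h x))
    (hd : ∀ C ≤ A, ∃ D ≤ C, ∃ x, R D x) :
    ∃ s : F.obj (op A), ∀ D (h : D ≤ A) x, R D x → res h s = x := by
  let S : Sieve A :=
    { arrows := fun V f => ∃ x, R V x
      downward_closed := by
        rintro V W f ⟨x, hx⟩ g
        exact ⟨_, hres _ _ (leOfHom g) _ hx⟩ }
  have hS : S ∈ (GrothendieckTopology.dense : GrothendieckTopology (NOpens Y)) A := by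
    intro V f
    obtain ⟨D, hD, x, hx⟩ := hd V (leOfHom f)
    exact ⟨D, homOfLE hD, x, hx⟩
  let y : Presieve.FamilyOfElements F (S : Presieve A) := fun V f hf => Exists.choose hf
  have hy : ∀ V (f : V ⟶ A) (hf : S f), R V (y f hf) := fun V f hf => Exists.choose_spec hf
  have hc : y.Compatible := by
    intro V W Z f g f' g' hf hg _
    exact hR _ _ _ (hres _ _ (leOfHom f) _ (hy V f' hf)) (hres _ _ (leOfHom g) _ (hy W g' hg))
  obtain ⟨s, hs, -⟩ := hF S hS y hc
  exact ⟨s, fun D h x hx => (hs (homOfLE h) ⟨x, hx⟩).trans (hR _ _ _ (hy D (homOfLE h) _) hx)⟩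

end Glue

/-! ### The action of morphisms on sections -/

section Act

variable {F G K : PreshStar.{u}}

/-- The action of `(i, Θ)` on a section of the source over a set containing `π_i(Reg A)`. -/
def PreshStar.Hom.act (a : F.Hom G) {U : NOpens F.space} {A : NOpens G.space}
    (h : (pushOpen a.hom).obj A ≤ U) (x : F.presheaf.obj (op U)) : G.presheaf.obj (op A) :=
  a.trans.app (op A) (res h x : F.presheaf.obj (op ((pushOpen a.hom).obj A)))

theorem PreshStar.Hom.act_res (a : F.Hom G) {U V : NOpens F.space} {A : NOpens G.space}
    (hV : (pushOpen a.hom).obj A ≤ V) (h : V ≤ U) (x : F.presheaf.obj (op U)) :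
    a.act hV (res h x) = a.act (hV.trans h) x := by
  unfold PreshStar.Hom.act
  rw [res_res]

theorem pushOpen_mono {X Y : Type u} [TopologicalSpace X] [TopologicalSpace Y]
    (i : CompleteHom (RO X) (RO Y)) {A A' : NOpens Y} (h : A' ≤ A) :
    (pushOpen i).obj A' ≤ (pushOpen i).obj A :=
  leOfHom ((pushOpen i).map (homOfLE h))

theorem PreshStar.Hom.res_act (a : F.Hom G) {U : NOpens F.space} {A A' : NOpens G.space}
    (hA : A' ≤ A) (h : (pushOpen a.hom).obj A ≤ U) (x : F.presheaf.obj (op U)) :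
    res hA (a.act h x) = a.act ((pushOpen_mono a.hom hA).trans h) x := by
  exact (ConcreteCategory.congr_hom (a.trans.naturality (homOfLE hA).op)
      (res h x : F.presheaf.obj (op ((pushOpen a.hom).obj A)))).symm.trans
    (congrArg (fun z : F.presheaf.obj (op ((pushOpen a.hom).obj A')) => a.trans.app (op A') z)
      (res_res h (pushOpen_mono a.hom hA) x))

theorem PreshStar.Hom.act_comp (a : F ⟶ G) (b : G ⟶ K) {U : NOpens F.space} {V : NOpens G.space}
    {A : NOpens K.space} (hU : (pushOpen (PreshStar.Hom.hom a)).obj V ≤ U)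
    (hV : (pushOpen (PreshStar.Hom.hom b)).obj A ≤ V)
    (h : (pushOpen (PreshStar.Hom.hom (a ≫ b))).obj A ≤ U) (x : F.presheaf.obj (op U)) :
    PreshStar.Hom.act (a ≫ b) h x = PreshStar.Hom.act b hV (PreshStar.Hom.act a hU x) := by
  conv_rhs => rw [PreshStar.Hom.act, PreshStar.Hom.res_act]
  change b.trans.app (op A) (a.trans.app _ (res (F := F.presheaf) _ (res h x))) =
    b.trans.app (op A) (a.trans.app _ _)
  rw [res_res]

/-- Natural transformations with different Boolean parts have different types; comparison through
`act` replaces transport along `e` by restriction along `hA`. -/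
theorem PreshStar.Hom.ext_act {a b : F.Hom G} (e : a.hom = b.hom)
    (h : ∀ (A : NOpens G.space) (x : F.presheaf.obj (op ((pushOpen a.hom).obj A)))
      (hA : (pushOpen b.hom).obj A ≤ (pushOpen a.hom).obj A), a.act le_rfl x = b.act hA x) :
    a = b := by
  obtain ⟨i, Θ⟩ := a
  obtain ⟨j, Ψ⟩ := b
  obtain rfl : i = j := e
  congr 1
  ext A x
  exact ((congrArg (Θ.app A) (res_self (F := F.presheaf) le_rfl x)).symm.trans
    (h A.unop x le_rfl)).trans (congrArg (Ψ.app A) (res_self (F := F.presheaf) le_rfl x))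

/-- Below every `C ≤ A` there is a smaller set whose image under `π_i ∘ Reg` lies where `x` and `y`
literally agree. Naturality gives equality there, and the target is separated for the dense
topology. -/
theorem PreshStar.Hom.act_eq_of_le_eqReg (hG : IsDenseSheaf G.presheaf) (a : F.Hom G)
    {U V : NOpens F.space} {A : NOpens G.space} (hU : (pushOpen a.hom).obj A ≤ U)
    (hV : (pushOpen a.hom).obj A ≤ V) {x : F.presheaf.obj (op U)} {y : F.presheaf.obj (op V)}
    (h : piReg a.hom A ≤ eqReg x y) : a.act hU x = a.act hV y := by
  refine hG.ext fun C hC => ?_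
  obtain ⟨W, hW, hWU, hWV, e⟩ := exists_res_eq (W := (pushOpen a.hom).obj C) (f := x) (g := y)
    (le_trans (show piReg a.hom C ≤ piReg a.hom A from pushOpen_mono a.hom hC) h)
  obtain ⟨q, hq⟩ := F.dense W
  have hqC : q.1 ≤ piReg a.hom C := fun _ hy => hW (hq hy)
  -- `D = C ∩ i(q)`: being contained in `i(q)` places `π_i(Reg D)` inside `q`, hence inside `W`.
  let D : NOpens G.space := ⟨_, inter_nonempty_of_le_piReg q.2 hqC⟩
  have hDq : (pushOpen a.hom).obj D ≤ (inclRO F.space).obj q :=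
    pushOpen_le_iff.2 (inf_le_right : C.1 ⊓ _ ≤ _)
  have hqW : (inclRO F.space).obj q ≤ W := hq
  have hDC : D ≤ C := (inf_le_left : C.1 ⊓ _ ≤ C.1)
  refine ⟨D, hDC, hDC.trans hC, ?_⟩
  rw [res_act, res_act, ← a.act_res (hDq.trans hqW) hWU, ← a.act_res (hDq.trans hqW) hWV, e]

end Act

/-! ### The unit and its universal property -/

section Unit

variable (F : PreshStar.{u})

theorem reg_piReg_unitHom_mem {X : Type u} [TopologicalSpace X] {A : NOpens (St (RO X))}
    {G : St (RO X)} (hG : G ∈ A.1) : reg ((pushOpen (unitHom X)).obj A).1 ∈ G :=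
  reg_mem_of_mem (U := piReg (unitHom X) A) (le_piReg (unitHom X) A hG)

/-- The unit `ℱ → Γ¹(Λ¹(ℱ))`, which maps `f` to the section `G ↦ [f]_G`. -/
noncomputable def unitMor : F.Hom (sheafifyObj F) where
  hom := unitHom F.space
  trans :=
    { app := fun A => ↾fun x =>
        (dotSec (F := F.presheaf) x A.unop.1 fun _ hG => reg_piReg_unitHom_mem hG :
        Sec F.presheaf A.unop.1)
      naturality := fun A A' f => by
        ext x
        refine Sec.ext_val (F := F.presheaf) (A := A'.unop.1) fun G hG => ?_
        exact congrArg _ (dot_res (pushOpen_mono (unitHom F.space) (leOfHom f.unop)) x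
          (reg_piReg_unitHom_mem hG)) }

/-- The unit, as an arrow of `Presh*(Set)`. -/
noncomputable abbrev unitArrow : F ⟶ sheafifyObj F := unitMor F

theorem unitMor_act_val {U : NOpens F.space} {A : NOpens (St (RO F.space))}
    (h : (pushOpen (unitMor F).hom).obj A ≤ U) (x : F.presheaf.obj (op U)) {G : St (RO F.space)}
    (hG : G ∈ A.1) (hU : reg U.1 ∈ G) :
    Sec.val (show Sec F.presheaf A.1 from (unitMor F).act h x) G hG =
      ((dot x G hU : Lambda1 F.presheaf) : OnePoint (Lambda1 F.presheaf)) :=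
  congrArg _ (dot_res h x (reg_piReg_unitHom_mem hG))

variable {F}
variable {G : PreshStar.{u}}

/-- Both sides have the same upper bounds, as each of these is some `N_w`. -/
theorem piReg_eq_nReg {X Y : Type u} [TopologicalSpace X] [TopologicalSpace Y]
    {i : CompleteHom (RO X) (RO Y)} {j : CompleteHom (RO (St (RO X))) (RO Y)}
    (h : ∀ w, j (nReg w) = i w) (A : NOpens Y) : piReg j A = nReg (piReg i A) := by
  refine eq_of_forall_ge_iff fun W => ?_
  obtain ⟨w, rfl⟩ := nReg_surjective W
  rw [piReg_le_iff, h, nReg_le_iff, piReg_le_iff]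

/-- The basic open set `N_q` as a nonempty open set. -/
abbrev nOpen {X : Type u} [TopologicalSpace X] (q : ROpos X) : NOpens (St (RO X)) :=
  ⟨Heyting.Regular.val (nReg q.1), St.exists_mem q.2⟩

theorem hom_nReg_of_unitMor_comp {a : F ⟶ G} {b : sheafifyObj F ⟶ G}
    (hb : unitArrow F ≫ b = a) (w : RO F.space) :
    PreshStar.Hom.hom b (nReg w) = PreshStar.Hom.hom a w := by
  subst hb
  rfl

/-- Over `N_q` the section `s` is the image of `f` under the unit, and `D ⊆ i(q)` means that `b`
sees over `D` only this restriction. Hence `b(s) = b(unit(f)) = a(f)` over `D`. -/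
theorem act_of_unitMor_comp {a : F ⟶ G} {b : sheafifyObj F ⟶ G}
    (hb : unitArrow F ≫ b = a) {P : NOpens (St (RO F.space))}
    (s : Sec F.presheaf P.1) {U : NOpens F.space} (f : F.presheaf.obj (op U)) {q : ROpos F.space}
    (hqP : nOpen q ≤ P) (hqU : (inclRO F.space).obj q ≤ U)
    (hs : ∀ H (hH : H ∈ P.1) (_ : q.1 ∈ H) (hU : reg U.1 ∈ H), s.val H hH =
      ((dot f H hU : Lambda1 F.presheaf) : OnePoint (Lambda1 F.presheaf)))
    {D : NOpens G.space} (hDP : (pushOpen (PreshStar.Hom.hom b)).obj D ≤ P)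
    (hDU : (pushOpen (PreshStar.Hom.hom a)).obj D ≤ U)
    (hD : D.1 ≤ (PreshStar.Hom.hom a q.1 : Opens G.space)) :
    PreshStar.Hom.act b (U := P) hDP s = PreshStar.Hom.act a hDU f := by
  have h1 : (pushOpen (PreshStar.Hom.hom b)).obj D ≤ nOpen q :=
    (piReg_le_iff (i := PreshStar.Hom.hom b) (b := nReg q.1)).2
      (hD.trans (hom_nReg_of_unitMor_comp hb q.1).ge)
  have h2 : (pushOpen (unitMor F).hom).obj (nOpen q) ≤ (inclRO F.space).obj q :=
    (pushOpen_le_iff (i := unitHom F.space) (A := nOpen q) (U := q)).2 le_rfl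
  have h3 : res (F := (sheafifyObj F).presheaf) hqP s = (unitMor F).act (h2.trans hqU) f := by
    refine Sec.ext_val (F := F.presheaf) (A := (nReg q.1 : Opens (St (RO F.space)))) fun H hH => ?_
    have hHU : reg U.1 ∈ H := H.mem_of_le (reg_mem_of_mem (U := q.1) hH) (reg_mono hqU)
    exact (hs H (hqP hH) hH hHU).trans (unitMor_act_val F (h2.trans hqU) f hH hHU).symm
  subst hb
  exact (PreshStar.Hom.act_res b h1 hqP s).symm.trans
    ((congrArg (PreshStar.Hom.act b h1) h3).trans
      (PreshStar.Hom.act_comp _ b (h2.trans hqU) h1 _ f).symm)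

theorem nReg_piReg_le {X Y : Type u} [TopologicalSpace X] [TopologicalSpace Y]
    {i : CompleteHom (RO X) (RO Y)} {j : CompleteHom (RO (St (RO X))) (RO Y)}
    (h : ∀ w, j (nReg w) = i w) {C A : NOpens Y} (hC : C ≤ A) :
    (nReg (piReg i C) : Opens (St (RO X))) ≤ ((pushOpen j).obj A).1 := by
  have h : nReg (piReg i C) ≤ piReg j C := (piReg_eq_nReg h C).ge
  exact fun _ hx => pushOpen_mono j hC (h hx)

/-- Sections of the sheafification are represented by sections of `F` on a dense family. -/
theorem exists_represented {a : F.Hom G} {P : NOpens (St (RO F.space))}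
    (s : Sec F.presheaf P.1) {C : NOpens G.space}
    (hC : (nReg (piReg a.hom C) : Opens (St (RO F.space))) ≤ P.1) :
    ∃ (D : NOpens G.space) (_ : D ≤ C) (q : ROpos F.space)
      (_ : D.1 ≤ (a.hom q.1 : Opens G.space)) (_ : nOpen q ≤ P)
      (f : F.presheaf.obj (op ((inclRO F.space).obj q))), ∀ H (hH : H ∈ P.1) (hq : q.1 ∈ H),
        s.val H hH = ((dot f H (reg_mem_of_mem hq) : Lambda1 F.presheaf) :
          OnePoint (Lambda1 F.presheaf)) := by
  obtain ⟨q, hq, f, hf⟩ := s.exists_eq_dotSec F.dense (pi_ne_bot a.hom ⟨_, reg_ne_bot C⟩) hC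
  exact ⟨⟨_, inter_nonempty_of_le_piReg q.2 hq⟩, (inf_le_left : C.1 ⊓ _ ≤ C.1), q,
    (inf_le_right : C.1 ⊓ _ ≤ _), (St.N_subset_iff.2 hq).trans hC, f, hf⟩

/-- The Boolean parts agree because every regular open set is some `N_w`. On sections, `s` is
represented over a dense family, where both morphisms are computed from the common composite. -/
theorem unitMor_comp_injective (hG : IsDenseSheaf G.presheaf) {b b' : sheafifyObj F ⟶ G}
    (h : unitArrow F ≫ b =
      unitArrow F ≫ b') : b = b' := by
  refine PreshStar.Hom.ext_act (CompleteHom.ext_fun fun W => ?_) fun A s hA => ?_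
  · obtain ⟨w, rfl⟩ := nReg_surjective W
    exact (hom_nReg_of_unitMor_comp h w).trans (hom_nReg_of_unitMor_comp rfl w).symm
  · refine hG.ext fun C hC => ?_
    obtain ⟨D, hD, q, hDq, hqP, f, hf⟩ := exists_represented
      (a := unitArrow F ≫ b') s
      (nReg_piReg_le (hom_nReg_of_unitMor_comp h) hC)
    refine ⟨D, hD, hD.trans hC, ?_⟩
    rw [PreshStar.Hom.res_act, PreshStar.Hom.res_act]
    have hDU : (pushOpen (PreshStar.Hom.hom
        (unitArrow F ≫ b'))).obj D ≤ (inclRO F.space).obj q :=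
      pushOpen_le_iff.2 hDq
    exact (act_of_unitMor_comp h s f hqP le_rfl (fun H hH hq _ => hf H hH hq) _ hDU hDq).trans
      (act_of_unitMor_comp rfl s f hqP le_rfl (fun H hH hq _ => hf H hH hq) _ hDU hDq).symm

end Unit

/-! ### Extending a morphism into a dense sheaf along the unit -/

section Universal

variable {F G : PreshStar.{u}}

/-- `y` is the value over `D` prescribed for a morphism extending `a` at the section `s` of the
sheafification: the image of a section of `F` which represents `s` on `N_{π_i(Reg D)}`. -/
def IsValue (a : F.Hom G) {P : NOpens (St (RO F.space))} (s : Sec F.presheaf P.1)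
    (D : NOpens G.space) (y : G.presheaf.obj (op D)) : Prop :=
  ∃ (_ : (nReg (piReg a.hom D) : Opens (St (RO F.space))) ≤ P.1) (U : NOpens F.space)
    (hU : (pushOpen a.hom).obj D ≤ U) (x : F.presheaf.obj (op U)),
    (∀ H (hH : H ∈ P.1) (_ : piReg a.hom D ∈ H) (hU : reg U.1 ∈ H), s.val H hH =
      ((dot x H hU : Lambda1 F.presheaf) : OnePoint (Lambda1 F.presheaf))) ∧ y = a.act hU x

/-- Two representatives have equal germs at every point of `N_{π_i(Reg D)}`, so their truth value is
at least `π_i(Reg D)` and `act_eq_of_le_eqReg` applies. -/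
theorem IsValue.unique (hG : IsDenseSheaf G.presheaf) {a : F.Hom G} {P : NOpens (St (RO F.space))}
    {s : Sec F.presheaf P.1} {D : NOpens G.space} {y y' : G.presheaf.obj (op D)}
    (h : IsValue a s D y) (h' : IsValue a s D y') : y = y' := by
  obtain ⟨hP, U, hU, x, hx, rfl⟩ := h
  obtain ⟨-, V, hV, x', hx', rfl⟩ := h'
  refine a.act_eq_of_le_eqReg hG hU hV (St.N_subset_iff.1 fun H hH => ?_)
  have h1 : reg U.1 ∈ H := H.mem_of_le (reg_mem_of_mem (U := piReg a.hom D) hH) (reg_mono hU)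
  have h2 : reg V.1 ∈ H := H.mem_of_le (reg_mem_of_mem (U := piReg a.hom D) hH) (reg_mono hV)
  exact dot_eq_dot_iff.1 (OnePoint.coe_injective
    ((hx H (hP hH) hH h1).symm.trans (hx' H (hP hH) hH h2)))

theorem IsValue.res {a : F.Hom G} {P : NOpens (St (RO F.space))} {s : Sec F.presheaf P.1}
    {D D' : NOpens G.space} (h : D' ≤ D) {y : G.presheaf.obj (op D)} (hy : IsValue a s D y) :
    IsValue a s D' (StoneanSheafification.res h y) := by
  obtain ⟨hP, U, hU, x, hx, rfl⟩ := hy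
  have hD : piReg a.hom D' ≤ piReg a.hom D := pushOpen_mono a.hom h
  exact ⟨le_trans (nReg_le_iff.2 hD) hP, U, _, x,
    fun H hH hq => hx H hH (H.mem_of_le hq hD), a.res_act h hU x⟩

theorem IsValue.restrict {a : F.Hom G} {P Q : NOpens (St (RO F.space))} {s : Sec F.presheaf P.1}
    {t : Sec F.presheaf Q.1} (hst : ∀ H hP hQ, s.val H hP = t.val H hQ)
    {D : NOpens G.space} (hPQ : Q ≤ P)
    (hQ : (nReg (piReg a.hom D) : Opens (St (RO F.space))) ≤ Q.1) {y : G.presheaf.obj (op D)}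
    (hy : IsValue a s D y) : IsValue a t D y := by
  obtain ⟨-, U, hU, x, hx, rfl⟩ := hy
  exact ⟨hQ, U, hU, x, fun H hH hq hU => (hst H (hPQ hH) hH).symm.trans (hx H (hPQ hH) hq hU), rfl⟩

theorem exists_isValue (a : F.Hom G) {P : NOpens (St (RO F.space))}
    (s : Sec F.presheaf P.1) {C : NOpens G.space}
    (hC : (nReg (piReg a.hom C) : Opens (St (RO F.space))) ≤ P.1) :
    ∃ D ≤ C, ∃ y, IsValue a s D y := by
  obtain ⟨D, hD, q, hDq, hqP, f, hf⟩ := exists_represented s hC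
  have hq : piReg a.hom D ≤ q.1 := piReg_le_iff.2 hDq
  exact ⟨D, hD, _, le_trans (nReg_le_iff.2 hq) hqP, _, pushOpen_le_iff.2 hDq, f,
    fun H hH hDH _ => hf H hH (H.mem_of_le hDH hq), rfl⟩

/-- The prescribed values glue by `exists_glue`. Naturality holds because a value of `s` is also a
value of its restrictions, so both sides agree on a dense family. -/
theorem exists_trans (hG : IsDenseSheaf G.presheaf) (a : F.Hom G)
    (j : CompleteHom (RO (St (RO F.space))) (RO G.space)) (hj : ∀ w, j (nReg w) = a.hom w) :
    ∃ Θ : (push j).obj (stoneanSheafify F.presheaf) ⟶ G.presheaf,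
      ∀ (A : NOpens G.space) (s : Sec F.presheaf ((pushOpen j).obj A).1) (D : NOpens G.space)
        (h : D ≤ A) (y : G.presheaf.obj (op D)), IsValue a s D y →
          res h (Θ.app (op A) s : G.presheaf.obj (op A)) = y := by
  have hle : ∀ {C A : NOpens G.space}, C ≤ A →
      (nReg (piReg a.hom C) : Opens (St (RO F.space))) ≤ ((pushOpen j).obj A).1 :=
    fun hC => nReg_piReg_le hj hC
  have hglue := fun (A : NOpens G.space) (s : Sec F.presheaf ((pushOpen j).obj A).1) =>
    hG.exists_glue (A := A) (IsValue a s) (fun D x y => IsValue.unique hG)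
      (fun D D' h x => IsValue.res h) (fun C hC => exists_isValue a s (hle hC))
  choose β hβ using hglue
  have hnat : ∀ {A A' : NOpens G.space} (h : A' ≤ A)
      (s : Sec F.presheaf ((pushOpen j).obj A).1) (t : Sec F.presheaf ((pushOpen j).obj A').1),
      (∀ H hP hQ, s.val H hP = t.val H hQ) → β A' t = res h (β A s) := by
    intro A A' h s t hst
    refine hG.ext fun C hC => ?_
    obtain ⟨D, hD, y, hy⟩ := exists_isValue a s (hle (hC.trans h))
    refine ⟨D, hD, hD.trans hC, ?_⟩
    rw [res_res, hβ A s D _ y hy]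
    exact hβ A' t D _ y (hy.restrict hst (pushOpen_mono j h) (hle (hD.trans hC)))
  refine ⟨⟨fun A => ↾(β A.unop), fun A A' f => ?_⟩, fun A s => hβ A s⟩
  ext s
  exact hnat (leOfHom f.unop) s _ fun _ _ hQ =>
    (stoneanSheafify_map_val F.presheaf ((pushOpen j).map f.unop) s hQ).symm

theorem unitMor_comp_act (b : (sheafifyObj F).Hom G) {U : NOpens F.space} {A : NOpens G.space}
    (hV : (pushOpen (unitHom F.space)).obj ((pushOpen b.hom).obj A) ≤ U)
    (h : (pushOpen ((unitHom F.space).comp b.hom)).obj A ≤ U) (x : F.presheaf.obj (op U)) :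
    PreshStar.Hom.act (F := F) (G := G) (unitArrow F ≫ b) h x =
      b.trans.app (op A) ((unitMor F).act hV x) :=
  (PreshStar.Hom.act_comp (unitMor F) b hV le_rfl h x).trans
    (congrArg (b.trans.app (op A)) (res_self (F := (sheafifyObj F).presheaf) le_rfl _))

theorem unitMor_comp_eq {a : F ⟶ G} (b : (sheafifyObj F).Hom G)
    (hj : ∀ w, b.hom (nReg w) = PreshStar.Hom.hom a w)
    (h : ∀ (A : NOpens G.space) (s : Sec F.presheaf ((pushOpen b.hom).obj A).1)
      (y : G.presheaf.obj (op A)), IsValue a s A y → b.trans.app (op A) s = y) :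
    unitArrow F ≫ (show sheafifyObj F ⟶ G from b) = a := by
  refine PreshStar.Hom.ext_act (CompleteHom.ext_fun hj) fun A x hA => ?_
  have hV : (pushOpen (unitHom F.space)).obj ((pushOpen b.hom).obj A) ≤
      (pushOpen ((unitHom F.space).comp b.hom)).obj A := (pushOpen_comp _ _ _).ge
  refine (unitMor_comp_act b hV le_rfl x).trans ?_
  exact h A _ _ ⟨nReg_piReg_le hj le_rfl, _, hA, x,
    fun H hH _ hU => unitMor_act_val F hV x hH hU, rfl⟩

theorem exists_unitMor_comp_eq (hG : IsDenseSheaf G.presheaf) (a : F ⟶ G) :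
    ∃ b : sheafifyObj F ⟶ G, unitArrow F ≫ b = a := by
  have hj : ∀ w, (unitHomInv F.space).comp (PreshStar.Hom.hom a) (nReg w) = PreshStar.Hom.hom a w :=
    fun w => congrArg (PreshStar.Hom.hom a) (unitHomInv_nReg w)
  -- From here on only the values of `j` on the sets `N_w` matter.
  generalize (unitHomInv F.space).comp (PreshStar.Hom.hom a) = j at hj
  obtain ⟨Θ, hΘ⟩ := exists_trans hG a j hj
  refine ⟨_, unitMor_comp_eq ⟨j, Θ⟩ hj fun A s y hy => ?_⟩
  exact (res_self le_rfl _).symm.trans (hΘ A s A le_rfl y hy)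

end Universal

/-! ### The action on morphisms -/

section Morphisms

variable {F G : PreshStar.{u}}

theorem res_act_app {K : PreshStar.{u}} (b : G.Hom K) {A D : NOpens K.space} (h : D ≤ A)
    (s : G.presheaf.obj (op ((pushOpen b.hom).obj A))) :
    res h (b.trans.app (op A) s : K.presheaf.obj (op A)) = b.act (pushOpen_mono b.hom h) s := by
  refine Eq.trans ?_ (b.res_act h le_rfl s)
  unfold PreshStar.Hom.act
  rw [res_self]

theorem comp_unitArrow_act_val (a : F ⟶ G) {U : NOpens F.space} {V : NOpens G.space}
    {A : NOpens (St (RO G.space))} (hU : (pushOpen (PreshStar.Hom.hom a)).obj V ≤ U)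
    (hV : (pushOpen (unitHom G.space)).obj A ≤ V)
    (h : (pushOpen (PreshStar.Hom.hom (a ≫ unitArrow G))).obj A ≤ U) (x : F.presheaf.obj (op U))
    {H : St (RO G.space)} (hH : H ∈ A.1) (hHV : reg V.1 ∈ H) :
    Sec.val (show Sec G.presheaf A.1 from PreshStar.Hom.act (a ≫ unitArrow G) h x) H hH =
      ((dot (PreshStar.Hom.act a hU x) H hHV : Lambda1 G.presheaf) :
        OnePoint (Lambda1 G.presheaf)) :=
  (congrArg (fun t : Sec G.presheaf A.1 => t.val H hH)
    (PreshStar.Hom.act_comp a (unitArrow G) hU hV h x)).trans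
    (unitMor_act_val G hV (PreshStar.Hom.act a hU x) hH hHV)

/-- A section with germ `[f]` at a point is given by `f` on a whole neighbourhood `N_q`. There
commutation with the units determines `b(s)` as the section of germs of the image of `f`. -/
theorem isSheafifiedMap_of_comm {a : F ⟶ G} {b : sheafifyObj F ⟶ sheafifyObj G}
    (h : unitArrow F ≫ b =
      a ≫ unitArrow G) : IsSheafifiedMap a b where
  hom_eq W H := by
    obtain ⟨w, rfl⟩ := nReg_surjective W
    have h1 : PreshStar.Hom.hom b (nReg w) = nReg (PreshStar.Hom.hom a w) :=
      hom_nReg_of_unitMor_comp h w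
    rw [h1]
    rfl
  trans_eq A s H hH hH' U hU f hs := by
    obtain ⟨q, hqH, hqU, hqP, hq⟩ := Sec.exists_eq_dot s hH' f _ hs
    have hqU' : q ≤ U.1 := hqU.trans (reg_coe U.1).le
    have hq0 : q ≠ ⊥ := fun e => (piStar a.hom H).bot_notMem (e ▸ hqH)
    -- `N_{i(q)}` is the preimage of `N_q` under the dual map, so `D` is a neighbourhood of `H` in
    -- `A` on which `f` represents `s`.
    let D : NOpens (St (RO G.space)) :=
      ⟨A.1 ⊓ Heyting.Regular.val (nReg (PreshStar.Hom.hom a q)), H, hH, hqH⟩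
    have hDA : D ≤ A := (inf_le_left : A.1 ⊓ _ ≤ A.1)
    have hDq : D.1 ≤ Heyting.Regular.val (nReg (PreshStar.Hom.hom a q)) := inf_le_right
    let V : NOpens G.space := (inclRO G.space).obj ⟨a.hom U.1, ne_bot_of_mem a.hom hU⟩
    have hVU : (pushOpen a.hom).obj V ≤ (inclRO F.space).obj U := pushOpen_image_le a.hom U _
    have hDV : (pushOpen (unitHom G.space)).obj D ≤ V :=
      (piReg_le_iff (i := unitHom G.space) (A := D) (b := a.hom U.1)).2
        (hDq.trans (nReg_le_iff.2 (a.hom.mono hqU')))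
    have hDU : (pushOpen (PreshStar.Hom.hom
        (a ≫ unitArrow G))).obj D ≤ (inclRO F.space).obj U :=
      (pushOpen_comp _ _ _).le.trans ((pushOpen_mono a.hom hDV).trans hVU)
    have h1 := act_of_unitMor_comp h s f (q := ⟨q, hq0⟩) hqP hqU'
      (fun K _ hK _ => hq K hK) (D := D) (pushOpen_mono b.hom hDA) hDU hDq
    have h2 := (congrArg (fun t : Sec G.presheaf D.1 => t.val H ⟨hH, hqH⟩)
      ((res_act_app b hDA s).trans h1))
    exact h2.trans (comp_unitArrow_act_val a hVU hDV hDU f ⟨hH, hqH⟩ (reg_mem_of_mem hU))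

/-- The germ formula, applied to sections in the image of the unit, gives the square at every point;
with `unitMor_comp_injective` it yields uniqueness of `b`. -/
theorem IsSheafifiedMap.comm {a : F ⟶ G} {b : sheafifyObj F ⟶ sheafifyObj G}
    (h : IsSheafifiedMap a b) : unitArrow F ≫ b =
      a ≫ unitArrow G := by
  have hn : ∀ w, PreshStar.Hom.hom b (nReg w) = nReg (PreshStar.Hom.hom a w) := by
    intro w
    refine Heyting.Regular.coe_injective (SetLike.ext fun H => ?_)
    exact h.hom_eq (nReg w) H
  refine PreshStar.Hom.ext_act (CompleteHom.ext_fun hn) fun A x hA => ?_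
  let P : NOpens (St (RO F.space)) := (pushOpen b.hom).obj A
  let U : ROpos F.space := ⟨piReg ((unitHom F.space).comp b.hom) A, pi_ne_bot _ ⟨_, reg_ne_bot A⟩⟩
  have hAU : A.1 ≤ Heyting.Regular.val (nReg (PreshStar.Hom.hom a U.1)) :=
    (le_piReg ((unitHom F.space).comp b.hom) A).trans (hn U.1).le
  have hV : (pushOpen (unitHom F.space)).obj P ≤ (inclRO F.space).obj U :=
    (pushOpen_comp _ _ _).ge
  refine (unitMor_comp_act b hV le_rfl x).trans ?_
  refine Sec.ext_val (F := G.presheaf) (A := A.1) fun H hH => ?_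
  have hU : a.hom U.1 ∈ H := hAU hH
  have hP : piStar a.hom H ∈ P.1 := by
    refine nReg_piReg_le (j := b.hom) (i := (unitHom F.space).comp b.hom) (fun _ => rfl)
      (le_refl A) ?_
    exact hU
  have hs := unitMor_act_val F hV x hP (reg_mem_of_mem hU)
  let V : NOpens G.space := (inclRO G.space).obj ⟨a.hom U.1, ne_bot_of_mem a.hom hU⟩
  have hVU : (pushOpen a.hom).obj V ≤ (inclRO F.space).obj U := pushOpen_image_le a.hom U _
  have hAV : (pushOpen (unitHom G.space)).obj A ≤ V :=
    (piReg_le_iff (i := unitHom G.space) (A := A) (b := a.hom U.1)).2 hAU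
  have h1 := h.trans_eq A ((unitMor F).act hV x) H hH hP U hU x hs
  exact h1.trans (comp_unitArrow_act_val a hVU hAV hA x hH (reg_mem_of_mem hU)).symm

end Morphisms

/-! ### The adjunction -/

theorem isStoneanSheaf_sheafifyObj (F : PreshStar.{u}) : isStoneanSheaf (sheafifyObj F) :=
  ⟨(St.compactSpace : CompactSpace (St (RO F.space))), (St.t2Space : T2Space (St (RO F.space))),
    (St.extremallyDisconnected : ExtremallyDisconnected (St (RO F.space))),
    isDenseSheaf_stoneanSheafify F.presheaf⟩

theorem isDenseSheaf_sheafifyObj (F : PreshStar.{u}) : IsDenseSheaf (sheafifyObj F).presheaf :=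
  isDenseSheaf_stoneanSheafify F.presheaf

/-- Morphisms from the sheafification of `F` to a dense sheaf `G` correspond to morphisms
`F ⟶ G`. -/
noncomputable def unitEquiv (F : PreshStar.{u}) {G : PreshStar.{u}}
    (hG : IsDenseSheaf G.presheaf) : (sheafifyObj F ⟶ G) ≃ (F ⟶ G) :=
  Equiv.ofBijective (fun b => unitArrow F ≫ b)
    ⟨fun _ _ h => unitMor_comp_injective hG h, exists_unitMor_comp_eq hG⟩

theorem unitArrow_comp_unitEquiv_symm {F G : PreshStar.{u}} (hG : IsDenseSheaf G.presheaf)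
    (a : F ⟶ G) : unitArrow F ≫ (unitEquiv F hG).symm a = a :=
  (unitEquiv F hG).apply_symm_apply a

theorem existsUnique_isSheafifiedMap {F G : PreshStar.{u}} (a : F ⟶ G) :
    ∃! b : sheafifyObj F ⟶ sheafifyObj G, IsSheafifiedMap a b := by
  have hG := isDenseSheaf_sheafifyObj G
  refine ⟨(unitEquiv F hG).symm (a ≫ unitArrow G),
    isSheafifiedMap_of_comm (unitArrow_comp_unitEquiv_symm hG _), fun b hb => ?_⟩
  rw [Equiv.eq_symm_apply]
  exact hb.comm

/-- The action of the sheafification on morphisms. -/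
noncomputable def sheafifyMap {F G : PreshStar.{u}} (a : F ⟶ G) : sheafifyObj F ⟶ sheafifyObj G :=
  (unitEquiv F (isDenseSheaf_sheafifyObj G)).symm (a ≫ unitArrow G)

theorem unitArrow_comp_sheafifyMap {F G : PreshStar.{u}} (a : F ⟶ G) :
    unitArrow F ≫ sheafifyMap a = a ≫ unitArrow G :=
  unitArrow_comp_unitEquiv_symm _ _

/-- The stonean sheafification functor. -/
noncomputable def sheafifyFunctor : PreshStar.{u} ⥤ ShStar.{u} where
  obj F := ⟨sheafifyObj F, isStoneanSheaf_sheafifyObj F⟩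
  map a := ObjectProperty.homMk (sheafifyMap a)
  map_id F := by
    apply ObjectProperty.hom_ext
    refine unitMor_comp_injective (isDenseSheaf_sheafifyObj F) ?_
    exact (unitArrow_comp_sheafifyMap (𝟙 F)).trans
      ((Category.id_comp _).trans (Category.comp_id _).symm)
  map_comp {F G K} a b := by
    apply ObjectProperty.hom_ext
    refine unitMor_comp_injective (isDenseSheaf_sheafifyObj K) ?_
    change unitArrow F ≫ sheafifyMap (a ≫ b) = unitArrow F ≫ sheafifyMap a ≫ sheafifyMap b
    rw [unitArrow_comp_sheafifyMap, ← Category.assoc, unitArrow_comp_sheafifyMap, Category.assoc,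
      Category.assoc, unitArrow_comp_sheafifyMap]

/-- The stonean sheafification is left adjoint to the inclusion. -/
noncomputable def sheafifyAdjunction : sheafifyFunctor.{u} ⊣ (isStoneanSheaf.{u}).ι :=
  Adjunction.mkOfHomEquiv
    { homEquiv := fun F G =>
        (isStoneanSheaf.fullyFaithfulι.homEquiv (X := sheafifyFunctor.obj F) (Y := G)).trans
          (unitEquiv F (G := G.obj) G.property.2.2.2)
      homEquiv_naturality_left_symm := by
        intro F' F G f g
        rw [Equiv.symm_apply_eq]
        change f ≫ g = unitArrow F' ≫ sheafifyMap f ≫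
          (unitEquiv F (G := G.obj) G.property.2.2.2).symm g
        rw [← Category.assoc, unitArrow_comp_sheafifyMap, Category.assoc,
          unitArrow_comp_unitEquiv_symm]
      homEquiv_naturality_right := by
        intro F G G' f g
        exact (Category.assoc (unitArrow F) f.hom g.hom).symm }

end StoneanSheafification

open StoneanSheafification

theorem mainTheorem5 :
    -- the sheafification of a presheaf on any space is a stonean sheaf
    (∀ (X : Type u) [TopologicalSpace X] (F : Presh X),
      CompactSpace (St (RO X)) ∧ T2Space (St (RO X)) ∧ ExtremallyDisconnected (St (RO X)) ∧
        IsDenseSheaf (stoneanSheafify F)) ∧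
    -- the action on morphisms is well defined
    (∀ (F G : PreshStar.{u}) (a : F ⟶ G),
      ∃! b : sheafifyObj F ⟶ sheafifyObj G, IsSheafifiedMap a b) ∧
    -- these actions form a functor, which is left adjoint to the inclusion
    ∃ (L : PreshStar.{u} ⥤ ShStar.{u}) (hL : ∀ F, (L.obj F).obj = sheafifyObj F),
      (∀ (F G : PreshStar.{u}) (a : F ⟶ G),
        IsSheafifiedMap a (eqToHom (hL F).symm ≫ (L.map a).hom ≫ eqToHom (hL G))) ∧
      Nonempty (L ⊣ (isStoneanSheaf.{u}).ι) := by
  refine ⟨fun X _ F => ⟨inferInstance, inferInstance, inferInstance,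
    isDenseSheaf_stoneanSheafify F⟩, fun F G a => existsUnique_isSheafifiedMap a,
    sheafifyFunctor, fun F => rfl, fun F G a => ?_, ⟨sheafifyAdjunction⟩⟩
  -- The object equalities hold by `rfl`, so both `eqToHom` are identities.
  change IsSheafifiedMap a (𝟙 (sheafifyObj F) ≫ sheafifyMap a ≫ 𝟙 (sheafifyObj G))
  rw [Category.id_comp, Category.comp_id]
  exact isSheafifiedMap_of_comm (unitArrow_comp_sheafifyMap a)
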